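/- **Theorem.** Let $\mathcal M$ be a smooth manifold with an affine connection $\nabla$, let $\mathcal R=C^\infty(\mathcal M)$ and $\mathcal V=\operatorname{Der}_{\mathbb R}(\mathcal R)$ be the $\mathcal R$-module of vector fields with its Jacobi bracket $[\![X,Y]\!]_J=XY-YX$, and write $X\rhd Y:=\nabla_XY$ and $X\rhd f:=Xf$ for $X,Y\in\mathcal V$, $f\in\mathcal R$. Torsion and curvature are $$t(a,b)=a\rhd b-b\rhd a-[\![a,b]\!]_J,\qquad R(a,b,c)=a\rhd(b\rhd c)-b\rhd(a\rhd c)-[\![a,b]\!]_J\rhd c .$$ For an $\mathcal R$-multilinear map $\varphi:\mathcal V^n\to\mathcal N$, where $\mathcal N=\mathcal R$ or $\mathcal V$, let $$(\nabla\varphi)(x_0,x_1,\dots,x_n)=x_0\rhd\varphi(x_1,\dots,x_n)-\sum_{i=1}^n\varphi(x_1,\dots,x_0\rhd x_i,\dots,x_n)$$ and $\nabla^m\varphi=\nabla(\nabla^{m-1}\varphi)$, $\nabla^0\varphi=\varphi$. Let $\mathcal A=T_{\mathcal R}(\mathcal V)$ be the tensor algebra of $\mathcal V$ over $\mathcal R$.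 It acts on $\mathcal N$ by higher-order covariant derivatives, $(x_1\cdots x_n)\rhd s=(\nabla^ns)(x_1,\dots,x_n)$. Let $\mathfrak g=\operatorname{Lie}_{\mathcal R}(\mathcal V)\subset\mathcal A$ be the free $\mathcal R$-Lie algebra on $\mathcal V$, with bracket $[u,v]=uv-vu$. Every $u\in\mathfrak g$ acts on $\mathcal R$ by a derivation, denoted $\rho(u)\in\mathcal V$. A *Lie monomial* of degree $n\ge 1$ is an $\mathcal R$-multilinear map $\alpha:\mathcal V^n\to\mathfrak g$ obtained by iterating brackets $[\cdot,\cdot]$, in which each of the $n$ variables occurs exactly once (in any order). It defines $\mathcal V$-valued tensors with $n$ and $n+1$ arguments, $$t_\alpha=-\rho\circ\alpha,\qquad R_\alpha(x_1,\dots,x_{n+1})=\bigl(\alpha(x_1,\dots,x_n)-\rho(\alpha(x_1,\dots,x_n))\bigr)\rhd x_{n+1}.$$ Let $\mathcal P(\mathcal V)$ be the operad of $\mathbb R$-multilinear maps on $\mathcal V$, with arity $n$ component $\mathcal P_n(\mathcal V)=\operatorname{Hom}_{\mathbb R}(\mathcal V^{\otimes n},\mathcal V)$, $n\ge0$. A suboperad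 consists of $\mathbb R$-linear subspaces of the $\mathcal P_n(\mathcal V)$, contains $\operatorname{Id}_{\mathcal V}$, and is stable under permutations of the variables and under composition. Let $\mathcal S(\mathcal V)$ (*special polynomials*) be the suboperad generated by $\{\nabla^mt,\nabla^mR: m\ge0\}$, and $\mathcal P_{\mathrm{Lie}}(\mathcal V)$ (*polynomials of Lie type*) the suboperad generated by $\{\nabla^mt_\alpha,\nabla^mR_\alpha: m\ge0,\ \alpha\text{ a Lie monomial}\}$. Then $$\mathcal P_{\mathrm{Lie}}(\mathcal V)=\mathcal S(\mathcal V).$$ -/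

import Mathlib

open scoped Manifold ContDiff

noncomputable section

namespace LiePoly

universe u v w

attribute [local instance] LieRing.ofAssociativeRing

/-! ### Connections and covariant derivatives of tensors -/

/-- A connection on an `R`-module `N` (the sections of a vector bundle), where vector fields are the
`k`-linear derivations of the `k`-algebra `R`: a map `(X, s) ↦ ∇_X s`, `R`-linear in `X` and
`k`-linear in `s`, such that `∇_X (f s) = (X f) s + f ∇_X s`. -/
structure Connection (k : Type w) (R : Type u) (N : Type v) [CommRing k] [CommRing R] [Algebra k R]
    [AddCommGroup N] [Module k N] [Module R N] [IsScalarTower k R N] where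
  nabla : Derivation k R R →ₗ[R] (N →ₗ[k] N)
  leibniz : ∀ (X : Derivation k R R) (f : R) (s : N),
    nabla X (f • s) = X f • s + f • nabla X s

/-- The natural connection on functions, `X ▷ f = X f`. -/
def Connection.fn (k : Type w) (R : Type u) [CommRing k] [CommRing R] [Algebra k R] :
    Connection k R R where
  nabla :=
    { toFun := fun X => (X : R →ₗ[k] R)
      map_add' := fun _ _ => rfl
      map_smul' := fun _ _ => rfl }
  leibniz := fun X f s => by simp [add_comm, mul_comm]

/-- An affine connection: a connection on the module of vector fields. -/
abbrev AffineConnection (k : Type w) (R : Type u) [CommRing k] [CommRing R] [Algebra k R] :=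
  Connection k R (Derivation k R R)

section

variable {k : Type w} {R : Type u} [CommRing k] [CommRing R] [Algebra k R]
  {N : Type v} [AddCommGroup N] [Module R N]

theorem covDeriv_aux_add {n : ℕ} (φ : MultilinearMap R (fun _ : Fin n => Derivation k R R) N)
    (g : Derivation k R R →ₗ[k] Derivation k R R) (t : Fin n → Derivation k R R) (j l : Fin n)
    (x y : Derivation k R R) :
    φ (Function.update (Function.update t j (x + y)) l (g (Function.update t j (x + y) l))) =
      φ (Function.update (Function.update t j x) l (g (Function.update t j x l))) +
      φ (Function.update (Function.update t j y) l (g (Function.update t j y l))) := by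
  by_cases h : l = j
  · subst h
    simp
  · simp only [Function.update_of_ne h, Function.update_comm (Ne.symm h),
      MultilinearMap.map_update_add]

theorem covDeriv_aux_smul (D : AffineConnection k R) {n : ℕ}
    (φ : MultilinearMap R (fun _ : Fin n => Derivation k R R) N)
    (X : Derivation k R R) (t : Fin n → Derivation k R R) (j l : Fin n)
    (c : R) (x : Derivation k R R) :
    φ (Function.update (Function.update t j (c • x)) l
        (D.nabla X (Function.update t j (c • x) l))) =
      (if l = j then X c • φ (Function.update t j x) else 0) +
      c • φ (Function.update (Function.update t j x) l
        (D.nabla X (Function.update t j x l))) := by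
  by_cases h : l = j
  · subst h
    simp [D.leibniz]
  · simp only [Function.update_of_ne h, Function.update_comm (Ne.symm h),
      MultilinearMap.map_update_smul, if_neg h, zero_add]

variable [Module k N] [IsScalarTower k R N]

/-- The covariant derivative of an `N`-valued tensor `φ`:
`(∇φ)(x₀, x₁, …, xₙ) = x₀ ▷ φ(x₁, …, xₙ) - ∑ᵢ φ(x₁, …, x₀ ▷ xᵢ, …, xₙ)`. -/
def covDeriv (D : AffineConnection k R) (E : Connection k R N) {n : ℕ}
    (φ : MultilinearMap R (fun _ : Fin n => Derivation k R R) N) :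
    MultilinearMap R (fun _ : Fin (n + 1) => Derivation k R R) N :=
  MultilinearMap.mk'
    (fun x => E.nabla (x 0) (φ (Fin.tail x)) -
      ∑ i, φ (Function.update (Fin.tail x) i (D.nabla (x 0) (Fin.tail x i))))
    (fun m i x y => by
      refine Fin.cases ?_ (fun j => ?_) i
      · simp only [Fin.tail_update_zero, Function.update_self, map_add,
          LinearMap.add_apply, MultilinearMap.map_update_add, Finset.sum_add_distrib]
        abel
      · simp only [Fin.tail_update_succ, MultilinearMap.map_update_add, map_add,
          Function.update_of_ne (Fin.succ_ne_zero j).symm]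
        rw [Finset.sum_congr rfl (fun l _ => covDeriv_aux_add φ (D.nabla (m 0)) (Fin.tail m) j l x y),
          Finset.sum_add_distrib]
        abel)
    (fun m i c x => by
      refine Fin.cases ?_ (fun j => ?_) i
      · simp only [Fin.tail_update_zero, Function.update_self, map_smul,
          LinearMap.smul_apply, MultilinearMap.map_update_smul, smul_sub, Finset.smul_sum]
      · simp only [Fin.tail_update_succ, MultilinearMap.map_update_smul, E.leibniz,
          Function.update_of_ne (Fin.succ_ne_zero j).symm]
        rw [Finset.sum_congr rfl (fun l _ => covDeriv_aux_smul D φ (m 0) (Fin.tail m) j l c x),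
          Finset.sum_add_distrib, ← Finset.smul_sum, Finset.sum_ite_eq' Finset.univ j]
        simp only [Finset.mem_univ, if_true, smul_sub]
        abel)

theorem covDeriv_apply (D : AffineConnection k R) (E : Connection k R N) {n : ℕ}
    (φ : MultilinearMap R (fun _ : Fin n => Derivation k R R) N)
    (x : Fin (n + 1) → Derivation k R R) :
    covDeriv D E φ x = E.nabla (x 0) (φ (Fin.tail x)) -
      ∑ i, φ (Function.update (Fin.tail x) i (D.nabla (x 0) (Fin.tail x i))) := by
  simp only [covDeriv, MultilinearMap.mk'_apply]

/-- The iterated covariant derivative `∇ᵐφ`; the `m` new arguments come first. -/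
def iterCovDeriv (D : AffineConnection k R) (E : Connection k R N) {n : ℕ}
    (φ : MultilinearMap R (fun _ : Fin n => Derivation k R R) N) :
    (m : ℕ) → MultilinearMap R (fun _ : Fin (n + m) => Derivation k R R) N
  | 0 => φ
  | m + 1 => covDeriv D E (iterCovDeriv D E φ m)

/-- The `n`-th covariant derivative `(x₁, …, xₙ) ↦ (x₁ ⋯ xₙ) ▷ s` of a section `s`, where
`(x₀ x₁ ⋯ xₙ) ▷ s = x₀ ▷ ((x₁ ⋯ xₙ) ▷ s) - (x₀ ▷ (x₁ ⋯ xₙ)) ▷ s`. -/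
def higherCovDeriv (D : AffineConnection k R) (E : Connection k R N) (s : N) :
    (n : ℕ) → MultilinearMap R (fun _ : Fin n => Derivation k R R) N
  | 0 => MultilinearMap.constOfIsEmpty R _ s
  | n + 1 => covDeriv D E (higherCovDeriv D E s n)

theorem higherCovDeriv_add (D : AffineConnection k R) (E : Connection k R N) (s t : N) (n : ℕ) :
    higherCovDeriv D E (s + t) n = higherCovDeriv D E s n + higherCovDeriv D E t n := by
  induction n with
  | zero => rfl
  | succ n ih =>
    ext x
    simp only [higherCovDeriv, covDeriv_apply, ih, add_apply, map_add,
      Finset.sum_add_distrib]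
    abel

theorem higherCovDeriv_smul (D : AffineConnection k R) (E : Connection k R N) (c : k) (s : N)
    (n : ℕ) (x : Fin n → Derivation k R R) :
    higherCovDeriv D E (c • s) n x = c • higherCovDeriv D E s n x := by
  induction n with
  | zero => rfl
  | succ n ih =>
    simp only [higherCovDeriv, covDeriv_apply, ih, map_smul, smul_sub, Finset.smul_sum]

/-! ### The tensor algebra `𝒜`, its action, and the free Lie algebra `𝔤` -/

/-- The tensor algebra `𝒜` over `R` of the module of vector fields. -/
abbrev TAlg (k : Type w) (R : Type u) [CommRing k] [CommRing R] [Algebra k R] :=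
  TensorAlgebra R (Derivation k R R)

/-- The action of the homogeneous tensors of degree `n`. -/
def actMultilinear (D : AffineConnection k R) (E : Connection k R N) (n : ℕ) :
    MultilinearMap R (fun _ : Fin n => Derivation k R R) (N →ₗ[k] N) where
  toFun x :=
    { toFun := fun s => higherCovDeriv D E s n x
      map_add' := fun s t => by rw [higherCovDeriv_add]; rfl
      map_smul' := fun c s => higherCovDeriv_smul D E c s n x }
  map_update_add' m i x y := by ext s; simp
  map_update_smul' m i c x := by ext s; simp

/-- The action `U ▷ s` of `U ∈ 𝒜` on `s ∈ N` by higher-order covariant derivatives. It is `R`-linear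
in `U`, and `(x₁ ⋯ xₙ) ▷ s` is given by `higherCovDeriv`. For `N = R`, this is the map `ρ` from `𝒜`
to differential operators. -/
def act (D : AffineConnection k R) (E : Connection k R N) : TAlg k R →ₗ[R] (N →ₗ[k] N) :=
  (DirectSum.toModule R ℕ (N →ₗ[k] N) fun n => PiTensorProduct.lift (actMultilinear D E n)) ∘ₗ
    (TensorAlgebra.equivDirectSum (R := R) (M := Derivation k R R)).toLinearMap

/-- The free `R`-Lie algebra `𝔤` on the module of vector fields, as the Lie subalgebra of `𝒜`
generated by the vector fields, with bracket `[u, v] = u v - v u`. -/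
def freeLie (k : Type w) (R : Type u) [CommRing k] [CommRing R] [Algebra k R] :
    LieSubalgebra R (TAlg k R) :=
  LieSubalgebra.lieSpan R (TAlg k R) (Set.range (TensorAlgebra.ι R))

/-! Elements of `𝔤` act on functions by derivations. -/

theorem act_tprod (D : AffineConnection k R) (E : Connection k R N) {n : ℕ}
    (x : Fin n → Derivation k R R) (s : N) :
    act D E (TensorAlgebra.tprod R _ n x) s = higherCovDeriv D E s n x := by
  simp only [act, LinearMap.comp_apply, AlgEquiv.toLinearMap_apply,
    TensorAlgebra.equivDirectSum_apply, TensorAlgebra.toDirectSum_tensorPower_tprod]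
  rw [← DirectSum.lof_eq_of R, DirectSum.toModule_lof, PiTensorProduct.lift.tprod]
  rfl

theorem act_one (D : AffineConnection k R) (E : Connection k R N) (s : N) :
    act D E 1 s = s := by
  have h := act_tprod D E (n := 0) Fin.elim0 s
  simpa [TensorAlgebra.tprod_apply, higherCovDeriv] using h

theorem act_algebraMap (D : AffineConnection k R) (E : Connection k R N) (f : R) (s : N) :
    act D E (algebraMap R _ f) s = f • s := by
  rw [Algebra.algebraMap_eq_smul_one, map_smul, LinearMap.smul_apply, act_one]

theorem tprod_cons {n : ℕ} (X : Derivation k R R) (x : Fin n → Derivation k R R) :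
    TensorAlgebra.tprod R _ (n + 1) (Fin.cons X x : Fin (n + 1) → Derivation k R R) =
      TensorAlgebra.ι R X * TensorAlgebra.tprod R _ n x := by
  simp [TensorAlgebra.tprod_apply, List.ofFn_succ]

theorem tAlg_induction {P : TAlg k R → Prop} (h0 : P 0) (hadd : ∀ a b, P a → P b → P (a + b))
    (hsmul : ∀ (f : R) a, P a → P (f • a))
    (hw : ∀ (n : ℕ) (x : Fin n → Derivation k R R), P (TensorAlgebra.tprod R _ n x))
    (a : TAlg k R) : P a := by
  rw [← TensorAlgebra.ofDirectSum_toDirectSum a]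
  induction TensorAlgebra.toDirectSum a using DirectSum.induction_on with
  | zero => simpa using h0
  | add x y hx hy => simpa using hadd _ _ hx hy
  | of n x =>
    induction x using PiTensorProduct.induction_on with
    | smul_tprod r x =>
      rw [← DirectSum.lof_eq_of R, map_smul, map_smul, DirectSum.lof_eq_of,
        TensorAlgebra.ofDirectSum_of_tprod]
      exact hsmul _ _ (hw n x)
    | add x y hx hy => simpa using hadd _ _ hx hy

/-- Twisted universal property of the tensor algebra. -/
theorem exists_ringHom {B : Type*} [Ring B] (i : R →+* B) (hi : ∀ f b, i f * b = b * i f)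
    (g : Derivation k R R →+ B) (hg : ∀ (f : R) y, g (f • y) = i f * g y) :
    ∃ F : TAlg k R →+* B, (∀ y, F (TensorAlgebra.ι R y) = g y) ∧
      ∀ f, F (algebraMap R _ f) = i f := by
  let _ : Algebra R B := i.toAlgebra' hi
  let g' : Derivation k R R →ₗ[R] B :=
    { toFun := g
      map_add' := g.map_add
      map_smul' := fun f y => by rw [hg, RingHom.id_apply, Algebra.smul_def]; rfl }
  refine ⟨(TensorAlgebra.lift R g').toRingHom, fun y => ?_, fun f => ?_⟩
  · exact TensorAlgebra.lift_ι_apply g' y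
  · exact (TensorAlgebra.lift R g').commutes f

theorem exists_derivation (D : AffineConnection k R) (X : Derivation k R R) :
    ∃ δ : TAlg k R →+ TAlg k R, (∀ a b, δ (a * b) = δ a * b + a * δ b) ∧
      (∀ y, δ (TensorAlgebra.ι R y) = TensorAlgebra.ι R (D.nabla X y)) ∧
      ∀ f, δ (algebraMap R _ f) = algebraMap R _ (X f) := by
  let i : R →+* TrivSqZeroExt (TAlg k R) (TAlg k R) :=
    { toFun := fun f => TrivSqZeroExt.inl (algebraMap R (TAlg k R) f) +
        TrivSqZeroExt.inr (algebraMap R (TAlg k R) (X f))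
      map_one' := by ext <;> simp
      map_zero' := by ext <;> simp
      map_add' := fun a b => by
        rw [map_add, map_add, map_add, TrivSqZeroExt.inl_add, TrivSqZeroExt.inr_add]
        abel
      map_mul' := fun a b => by
        ext
        · simp
        · simp only [TrivSqZeroExt.snd_add, TrivSqZeroExt.snd_mul, TrivSqZeroExt.snd_inl,
            TrivSqZeroExt.snd_inr, TrivSqZeroExt.fst_add, TrivSqZeroExt.fst_inl,
            TrivSqZeroExt.fst_inr, Derivation.leibniz, map_add, smul_eq_mul, map_mul,
            add_zero, zero_add, MulOpposite.smul_eq_mul_unop,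
            MulOpposite.unop_op]
          rw [← map_mul, ← map_mul, ← map_mul, mul_comm b] }
  let g : Derivation k R R →+ TrivSqZeroExt (TAlg k R) (TAlg k R) :=
    { toFun := fun y => TrivSqZeroExt.inl (TensorAlgebra.ι R y) +
        TrivSqZeroExt.inr (TensorAlgebra.ι R (D.nabla X y))
      map_zero' := by ext <;> simp
      map_add' := fun a b => by ext <;> simp }
  obtain ⟨F, hF1, hF2⟩ := exists_ringHom i
    (fun f b => by
      ext
      · simp [i, Algebra.commutes]
      · simp [i, Algebra.commutes, add_comm])
    g
    (fun f y => by
      ext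
      · simp [i, g, Algebra.smul_def]
      · simp only [i, g, AddMonoidHom.coe_mk, ZeroHom.coe_mk, RingHom.coe_mk, MonoidHom.coe_mk,
          OneHom.coe_mk, TrivSqZeroExt.snd_add, TrivSqZeroExt.snd_mul, TrivSqZeroExt.snd_inl,
          TrivSqZeroExt.snd_inr, TrivSqZeroExt.fst_add, TrivSqZeroExt.fst_inl,
          TrivSqZeroExt.fst_inr, D.leibniz, map_add, map_smul, smul_eq_mul, add_zero, zero_add,
          MulOpposite.smul_eq_mul_unop, MulOpposite.unop_op]
        rw [Algebra.smul_def, Algebra.smul_def, add_comm])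
  have hfst : ∀ a, (F a).fst = a := by
    intro a
    induction a using TensorAlgebra.induction with
    | algebraMap r => simp [hF2, i]
    | ι x => simp [hF1, g]
    | mul a b ha hb => simp [ha, hb]
    | add a b ha hb => simp [ha, hb]
  refine ⟨⟨⟨fun a => (F a).snd, by simp⟩, fun a b => by simp⟩, fun a b => ?_, fun y => ?_,
    fun f => ?_⟩
  · simp [hfst, add_comm]
  · simp [hF1, g]
  · simp only [AddMonoidHom.coe_mk, ZeroHom.coe_mk, hF2, i, RingHom.coe_mk, MonoidHom.coe_mk,
      OneHom.coe_mk, TrivSqZeroExt.snd_add, TrivSqZeroExt.snd_inl, TrivSqZeroExt.snd_inr, zero_add]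

theorem derivation_tprod (D : AffineConnection k R) (X : Derivation k R R)
    (δ : TAlg k R →+ TAlg k R) (hmul : ∀ a b, δ (a * b) = δ a * b + a * δ b)
    (hι : ∀ y, δ (TensorAlgebra.ι R y) = TensorAlgebra.ι R (D.nabla X y))
    (hf : ∀ f, δ (algebraMap R _ f) = algebraMap R _ (X f))
    (n : ℕ) (x : Fin n → Derivation k R R) :
    δ (TensorAlgebra.tprod R _ n x) =
      ∑ i, TensorAlgebra.tprod R _ n (Function.update x i (D.nabla X (x i))) := by
  induction n with
  | zero =>
    have := hf 1
    simp only [map_one, Derivation.map_one_eq_zero, map_zero] at this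
    simpa [TensorAlgebra.tprod_apply] using this
  | succ n ih =>
    obtain ⟨y, z, rfl⟩ : ∃ y z, x = Fin.cons y z := ⟨x 0, Fin.tail x, (Fin.cons_self_tail x).symm⟩
    rw [tprod_cons, hmul, hι, ih, Fin.sum_univ_succ, Finset.mul_sum]
    simp only [Fin.cons_zero, Fin.cons_succ, Fin.update_cons_zero, ← Fin.cons_update, tprod_cons]

theorem act_ι_mul (D : AffineConnection k R) (E : Connection k R N) (X : Derivation k R R)
    (δ : TAlg k R →+ TAlg k R) (hmul : ∀ a b, δ (a * b) = δ a * b + a * δ b)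
    (hι : ∀ y, δ (TensorAlgebra.ι R y) = TensorAlgebra.ι R (D.nabla X y))
    (hf : ∀ f, δ (algebraMap R _ f) = algebraMap R _ (X f)) (a : TAlg k R) (s : N) :
    act D E (TensorAlgebra.ι R X * a) s = E.nabla X (act D E a s) - act D E (δ a) s := by
  induction a using tAlg_induction with
  | h0 => simp
  | hadd a b ha hb => 
    simp only [mul_add, map_add, LinearMap.add_apply, ha, hb]
    abel
  | hsmul f a ha =>
    rw [mul_smul_comm, Algebra.smul_def f a, hmul, hf, ← Algebra.smul_def, ← Algebra.smul_def,
      ← Algebra.smul_def]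
    simp only [map_add, map_smul, LinearMap.add_apply, LinearMap.smul_apply, ha, E.leibniz,
      smul_sub]
    abel
  | hw n x =>
    rw [derivation_tprod D X δ hmul hι hf, ← tprod_cons, act_tprod]
    simp only [map_sum, LinearMap.sum_apply, act_tprod, higherCovDeriv, covDeriv_apply,
      Fin.cons_zero, Fin.tail_cons]

theorem act_ι (D : AffineConnection k R) (E : Connection k R N) (X : Derivation k R R) (s : N) :
    act D E (TensorAlgebra.ι R X) s = E.nabla X s := by
  obtain ⟨δ, h1, h2, h3⟩ := exists_derivation D X
  have h := act_ι_mul D E X δ h1 h2 h3 1 s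
  have h0 := h3 1
  simp only [map_one, Derivation.map_one_eq_zero, map_zero] at h0
  simpa [h0, act_one] using h

end

section

variable {k : Type w} {R : Type u} [CommRing k] [CommRing R] [Algebra k R]

/-- `u ∈ 𝒜` acts by derivations on `𝒜` and on all modules with connection, compatibly with the
product of `𝒜`. -/
def ActsByDerivations (D : AffineConnection k R) (u : TAlg k R) : Prop :=
  ∃ δ : TAlg k R →+ TAlg k R, (∀ a b, δ (a * b) = δ a * b + a * δ b) ∧
    (∀ y, δ (TensorAlgebra.ι R y) = TensorAlgebra.ι R (act D D u y)) ∧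
    (∀ f, δ (algebraMap R _ f) = algebraMap R _ (act D (Connection.fn k R) u f)) ∧
    ∀ (N : Type u) [AddCommGroup N] [Module k N] [Module R N] [IsScalarTower k R N]
      (E : Connection k R N),
      (∀ a s, act D E (u * a) s = act D E u (act D E a s) - act D E (δ a) s) ∧
      ∀ (f : R) s, act D E u (f • s) =
        act D (Connection.fn k R) u f • s + f • act D E u s

/-- The elements of `𝒜` that act by derivations form an `R`-module. -/
def derivationActing (D : AffineConnection k R) : Submodule R (TAlg k R) where
  carrier := {u | ActsByDerivations D u}
  zero_mem' := ⟨0, by simp, by simp, by simp, fun N _ _ _ _ E => ⟨by simp, by simp⟩⟩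
  add_mem' := by
    rintro u v ⟨δ, h1, h2, h3, h4⟩ ⟨ε, g1, g2, g3, g4⟩
    refine ⟨δ + ε, fun a b => ?_, by simp [h2, g2], by simp [h3, g3],
      fun N _ _ _ _ E => ⟨fun a s => ?_, fun f s => ?_⟩⟩
    · simp only [AddMonoidHom.add_apply, h1, g1, add_mul, mul_add]
      abel
    · simp only [add_mul, map_add, LinearMap.add_apply, (h4 N E).1, (g4 N E).1,
        AddMonoidHom.add_apply]
      abel
    · simp only [map_add, LinearMap.add_apply, (h4 N E).2, (g4 N E).2, add_smul, smul_add]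
      abel
  smul_mem' := by
    rintro c u ⟨δ, h1, h2, h3, h4⟩
    refine ⟨(AddMonoidHom.mulLeft (algebraMap R (TAlg k R) c)).comp δ, fun a b => ?_, fun y => ?_,
      fun f => ?_, fun N _ _ _ _ E => ⟨fun a s => ?_, fun f s => ?_⟩⟩
    · simp only [AddMonoidHom.comp_apply, AddMonoidHom.coe_mulLeft, h1, ← Algebra.smul_def,
        smul_add, smul_mul_assoc, mul_smul_comm]
    · simp only [AddMonoidHom.comp_apply, AddMonoidHom.coe_mulLeft, h2, ← Algebra.smul_def,
        map_smul, LinearMap.smul_apply]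
    · simp only [AddMonoidHom.comp_apply, AddMonoidHom.coe_mulLeft, h3,
        map_smul, LinearMap.smul_apply, smul_eq_mul, map_mul]
    · simp only [AddMonoidHom.comp_apply, AddMonoidHom.coe_mulLeft, ← Algebra.smul_def,
        map_smul, LinearMap.smul_apply, smul_mul_assoc, (h4 N E).1, smul_sub]
    · simp only [map_smul, LinearMap.smul_apply, (h4 N E).2, smul_add, smul_eq_mul, mul_smul,
        smul_comm c f]

theorem ι_mem_derivationActing (D : AffineConnection k R) (X : Derivation k R R) :
    TensorAlgebra.ι R X ∈ derivationActing D := by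
  obtain ⟨δ, h1, h2, h3⟩ := exists_derivation D X
  refine ⟨δ, h1, fun y => by rw [h2, act_ι], fun f => by rw [h3, act_ι]; rfl,
    fun N _ _ _ _ E => ⟨fun a s => ?_, fun f s => ?_⟩⟩
  · rw [act_ι_mul D E X δ h1 h2 h3, act_ι]
  · simp only [act_ι, E.leibniz]; rfl

/-- Iterated brackets of `n` vector fields. -/
inductive IsLieWord : ℕ → TAlg k R → Prop
  | ι (X : Derivation k R R) : IsLieWord 1 (TensorAlgebra.ι R X)
  | bracket {m n : ℕ} {a b : TAlg k R} :
      IsLieWord m a → IsLieWord n b → IsLieWord (m + n) ⁅a, b⁆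

theorem IsLieWord.pos {n : ℕ} {a : TAlg k R} (h : IsLieWord n a) : 0 < n := by
  induction h <;> omega

theorem lie_mem_span {m n : ℕ} {a b : TAlg k R}
    (ha : a ∈ Submodule.span R {c | IsLieWord m c}) (hb : b ∈ Submodule.span R {c | IsLieWord n c}) :
    ⁅a, b⁆ ∈ Submodule.span R {c : TAlg k R | IsLieWord (m + n) c} := by
  induction ha using Submodule.span_induction with
  | zero => simp
  | add x y _ _ hx hy => rw [add_lie]; exact add_mem hx hy
  | smul r x _ hx => rw [smul_lie]; exact Submodule.smul_mem _ _ hx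
  | mem x hx =>
    induction hb using Submodule.span_induction with
    | zero => simp
    | add x y _ _ hx hy => rw [lie_add]; exact add_mem hx hy
    | smul r x _ hx => rw [lie_smul]; exact Submodule.smul_mem _ _ hx
    | mem y hy => exact Submodule.subset_span (IsLieWord.bracket hx hy)

theorem derivation_lieWord (δ : TAlg k R →+ TAlg k R) (hmul : ∀ a b, δ (a * b) = δ a * b + a * δ b)
    (hι : ∀ y, ∃ z, δ (TensorAlgebra.ι R y) = TensorAlgebra.ι R z) {n : ℕ} {a : TAlg k R}
    (ha : IsLieWord n a) : δ a ∈ Submodule.span R {c : TAlg k R | IsLieWord n c} := by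
  induction ha with
  | ι X =>
    obtain ⟨z, hz⟩ := hι X
    rw [hz]
    exact Submodule.subset_span (IsLieWord.ι z)
  | @bracket m n a b ha hb iha ihb =>
    have : δ ⁅a, b⁆ = ⁅δ a, b⁆ + ⁅a, δ b⁆ := by
      simp only [LieRing.of_associative_ring_bracket, map_sub, hmul]
      abel
    rw [this]
    exact add_mem (lie_mem_span iha (Submodule.subset_span hb))
      (lie_mem_span (Submodule.subset_span ha) ihb)

theorem bracket_mem_derivationActing (D : AffineConnection k R) {u v : TAlg k R} 
    (hu : ActsByDerivations D u) (hv : ActsByDerivations D v)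
    (H : ∀ (δ : TAlg k R →+ TAlg k R), (∀ a b, δ (a * b) = δ a * b + a * δ b) →
      (∀ y, ∃ z, δ (TensorAlgebra.ι R y) = TensorAlgebra.ι R z) →
      ActsByDerivations D (δ u) ∧ ActsByDerivations D (δ v)) :
    ActsByDerivations D ⁅u, v⁆ := by
  obtain ⟨δ, h1, h2, h3, h4⟩ := hu
  obtain ⟨ε, g1, g2, g3, g4⟩ := hv
  obtain ⟨δ', h1', h2', h3', h4'⟩ := (H δ h1 fun y => ⟨_, h2 y⟩).2
  obtain ⟨ε', g1', g2', g3', g4'⟩ := (H ε g1 fun y => ⟨_, g2 y⟩).1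
  refine ⟨δ.comp ε - ε.comp δ - δ' + ε', fun a b => ?_, fun y => ?_, fun f => ?_,
    fun N _ _ _ _ E => ⟨fun a s => ?_, fun f s => ?_⟩⟩
  · simp only [AddMonoidHom.add_apply, AddMonoidHom.sub_apply, AddMonoidHom.comp_apply, h1, g1, h1',
      g1', map_add]
    noncomm_ring
  · simp only [AddMonoidHom.add_apply, AddMonoidHom.sub_apply, AddMonoidHom.comp_apply, h2, g2, h2',
      g2', LieRing.of_associative_ring_bracket, map_sub, LinearMap.sub_apply, (h4 _ D).1,
      (g4 _ D).1]
    abel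
  · simp only [AddMonoidHom.add_apply, AddMonoidHom.sub_apply, AddMonoidHom.comp_apply, h3, g3, h3',
      g3', LieRing.of_associative_ring_bracket, map_sub, LinearMap.sub_apply, (h4 _ _).1,
      (g4 _ _).1]
    abel
  · simp only [LieRing.of_associative_ring_bracket, sub_mul, mul_assoc, map_sub, map_add,
      LinearMap.sub_apply, LinearMap.add_apply, (h4 _ E).1, (g4 _ E).1, (h4' _ E).1, (g4' _ E).1,
      h1, g1, AddMonoidHom.add_apply, AddMonoidHom.sub_apply, AddMonoidHom.comp_apply]
    abel
  · simp only [LieRing.of_associative_ring_bracket, map_sub, map_add,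
      LinearMap.sub_apply, (h4 _ _).1, (g4 _ _).1, (h4 _ E).2, (g4 _ E).2,
      (h4' _ E).2, (g4' _ E).2, sub_smul, smul_sub]
    abel

theorem lieWord_mem_derivationActing (D : AffineConnection k R) (n : ℕ) :
    ∀ a : TAlg k R, IsLieWord n a → a ∈ derivationActing D := by
  induction n using Nat.strong_induction_on with
  | _ n ih =>
    intro a ha
    cases ha with
    | ι X => exact ι_mem_derivationActing D X
    | @bracket m n a b ha hb =>
      have hm := ha.pos
      have hn := hb.pos
      refine bracket_mem_derivationActing D (ih m (by omega) a ha) (ih n (by omega) b hb) ?_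
      intro δ h1 h2
      exact ⟨Submodule.span_le.2 (fun c hc => ih m (by omega) c hc) (derivation_lieWord δ h1 h2 ha),
        Submodule.span_le.2 (fun c hc => ih n (by omega) c hc) (derivation_lieWord δ h1 h2 hb)⟩

theorem freeLie_mem_derivationActing (D : AffineConnection k R) {u : TAlg k R}
    (hu : u ∈ freeLie k R) : u ∈ derivationActing D := by
  let S : Set (TAlg k R) := {c | ∃ n, IsLieWord n c}
  let L : LieSubalgebra R (TAlg k R) :=
    { Submodule.span R S with
      lie_mem' := by
        intro a b ha hb
        change a ∈ Submodule.span R S at ha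
        change b ∈ Submodule.span R S at hb
        change ⁅a, b⁆ ∈ Submodule.span R S
        induction ha using Submodule.span_induction with
        | zero => simp
        | add x y _ _ hx hy => rw [add_lie]; exact add_mem hx hy
        | smul r x _ hx => rw [smul_lie]; exact Submodule.smul_mem _ _ hx
        | mem x hx =>
          induction hb using Submodule.span_induction with
          | zero => simp
          | add x y _ _ hx hy => rw [lie_add]; exact add_mem hx hy
          | smul r x _ hx => rw [lie_smul]; exact Submodule.smul_mem _ _ hx
          | mem y hy =>
            obtain ⟨m, hm⟩ := hx
            obtain ⟨n, hn⟩ := hy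
            exact Submodule.subset_span ⟨_, hm.bracket hn⟩ }
  have hL : freeLie k R ≤ L := LieSubalgebra.lieSpan_le.2 (by
    rintro _ ⟨X, rfl⟩
    exact Submodule.subset_span (s := S) ⟨1, IsLieWord.ι X⟩)
  have h : u ∈ Submodule.span R S := hL hu
  have hS : Submodule.span R S ≤ derivationActing D := by
    refine Submodule.span_le.2 ?_
    rintro c ⟨n, hn⟩
    exact lieWord_mem_derivationActing D n c hn
  exact hS h

theorem act_freeLie_smul (D : AffineConnection k R) {N : Type u} [AddCommGroup N] [Module k N]
    [Module R N] [IsScalarTower k R N] (E : Connection k R N) (u : freeLie k R) (f : R) (s : N) :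
    act D E (u : TAlg k R) (f • s) =
      act D (Connection.fn k R) (u : TAlg k R) f • s + f • act D E (u : TAlg k R) s := by
  obtain ⟨_, _, _, _, h⟩ := freeLie_mem_derivationActing D u.2
  exact (h N E).2 f s

/-! ### The anchor, torsion and curvature, and the tensors of a Lie monomial -/

/-- The anchor `ρ : 𝔤 → 𝒱`, `ρ(u) f = u ▷ f`. -/
def rho (D : AffineConnection k R) : freeLie k R →ₗ[R] Derivation k R R where
  toFun u := Derivation.mk' (act D (Connection.fn k R) (u : TAlg k R)) (fun a b => by
    have h := act_freeLie_smul D (Connection.fn k R) u a b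
    simp only [smul_eq_mul] at h ⊢
    rw [h]
    ring)
  map_add' u v := by ext f; simp
  map_smul' c u := by ext f; simp

/-- The inclusion `𝒱 ⊆ 𝔤`. -/
def incl (k : Type w) (R : Type u) [CommRing k] [CommRing R] [Algebra k R] :
    Derivation k R R →ₗ[R] freeLie k R :=
  (TensorAlgebra.ι R).codRestrict (freeLie k R).toSubmodule
    (fun X => LieSubalgebra.subset_lieSpan ⟨X, rfl⟩)

/-- For `u ∈ 𝔤`, the `R`-linear map `Y ↦ (u - ρ(u)) ▷ Y`. -/
def curvAct (D : AffineConnection k R) :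
    freeLie k R →ₗ[R] (Derivation k R R →ₗ[R] Derivation k R R) where
  toFun u :=
    { toFun := fun Y => act D D ((u - incl k R (rho D u) : freeLie k R) : TAlg k R) Y
      map_add' := fun _ _ => map_add _ _ _
      map_smul' := fun f Y => by
        have h : act D (Connection.fn k R)
            ((u - incl k R (rho D u) : freeLie k R) : TAlg k R) f = 0 := by
          have h1 : ((u - incl k R (rho D u) : freeLie k R) : TAlg k R) =
            (u : TAlg k R) - TensorAlgebra.ι R (rho D u) := rfl
          rw [h1, map_sub, LinearMap.sub_apply, act_ι]
          exact sub_self _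
        rw [act_freeLie_smul, h, zero_smul, zero_add, RingHom.id_apply] }
  map_add' u v := by
    ext1 Y
    simp only [map_add, LinearMap.coe_mk, AddHom.coe_mk, LinearMap.add_apply, add_sub_add_comm]
    exact LinearMap.congr_fun (map_add (act D D) _ _) Y
  map_smul' c u := by
    ext1 Y
    simp only [map_smul, LinearMap.coe_mk, AddHom.coe_mk, LinearMap.smul_apply, ← smul_sub,
      RingHom.id_apply]
    exact LinearMap.congr_fun (map_smul (act D D) c _) Y

/-- The torsion `t(a, b) = a ▷ b - b ▷ a - ⁅a, b⁆`, where `⁅a, b⁆` is the Jacobi bracket. -/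
def torsion (D : AffineConnection k R) :
    MultilinearMap R (fun _ : Fin 2 => Derivation k R R) (Derivation k R R) :=
  MultilinearMap.mk' (fun x => D.nabla (x 0) (x 1) - D.nabla (x 1) (x 0) - ⁅x 0, x 1⁆)
    (fun m i x y => by
      fin_cases i <;> simp <;> abel)
    (fun m i c x => by
      have h1 : ∀ a b : Derivation k R R, ⁅c • a, b⁆ = c • ⁅a, b⁆ - b c • a := fun a b => by
        ext f; simp [Derivation.commutator_apply]; ring
      have h2 : ∀ a b : Derivation k R R, ⁅a, c • b⁆ = c • ⁅a, b⁆ + a c • b := fun a b => by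
        ext f; simp [Derivation.commutator_apply]
      fin_cases i <;> simp [h1, h2, D.leibniz, smul_sub] <;> abel)

/-- The curvature `R(a, b, c) = a ▷ (b ▷ c) - b ▷ (a ▷ c) - ⁅a, b⁆ ▷ c`. -/
def curvature (D : AffineConnection k R) :
    MultilinearMap R (fun _ : Fin 3 => Derivation k R R) (Derivation k R R) :=
  MultilinearMap.mk'
    (fun x => D.nabla (x 0) (D.nabla (x 1) (x 2)) - D.nabla (x 1) (D.nabla (x 0) (x 2)) -
      D.nabla ⁅x 0, x 1⁆ (x 2))
    (fun m i x y => by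
      fin_cases i <;> simp <;> abel)
    (fun m i c x => by
      have h1 : ∀ a b : Derivation k R R, ⁅c • a, b⁆ = c • ⁅a, b⁆ - b c • a := fun a b => by
        ext f; simp [Derivation.commutator_apply]; ring
      have h2 : ∀ a b : Derivation k R R, ⁅a, c • b⁆ = c • ⁅a, b⁆ + a c • b := fun a b => by
        ext f; simp [Derivation.commutator_apply]
      fin_cases i <;> simp [h1, h2, D.leibniz, smul_sub, Derivation.commutator_apply, sub_smul] <;>
        abel)

theorem update_castAdd_left {V : Type*} {m n : ℕ} (x : Fin (m + n) → V) (j : Fin m) (a : V) :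
    (fun i => Function.update x (Fin.castAdd n j) a (Fin.castAdd n i)) =
      Function.update (fun i => x (Fin.castAdd n i)) j a :=
  Function.update_comp_eq_of_injective x (Fin.castAdd_injective m n) j a

theorem update_castAdd_right {V : Type*} {m n : ℕ} (x : Fin (m + n) → V) (j : Fin m) (a : V) :
    (fun i => Function.update x (Fin.castAdd n j) a (Fin.natAdd m i)) =
      fun i => x (Fin.natAdd m i) := by
  ext i
  refine Function.update_of_ne (fun h => ?_) _ _
  have := congrArg Fin.val h
  simp only [Fin.val_natAdd, Fin.val_castAdd] at this
  omega

theorem update_natAdd_left {V : Type*} {m n : ℕ} (x : Fin (m + n) → V) (j : Fin n) (a : V) :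
    (fun i => Function.update x (Fin.natAdd m j) a (Fin.castAdd n i)) =
      fun i => x (Fin.castAdd n i) := by
  ext i
  refine Function.update_of_ne (fun h => ?_) _ _
  have := congrArg Fin.val h
  simp only [Fin.val_natAdd, Fin.val_castAdd] at this
  omega

theorem update_natAdd_right {V : Type*} {m n : ℕ} (x : Fin (m + n) → V) (j : Fin n) (a : V) :
    (fun i => Function.update x (Fin.natAdd m j) a (Fin.natAdd m i)) =
      Function.update (fun i => x (Fin.natAdd m i)) j a :=
  Function.update_comp_eq_of_injective x (Fin.natAdd_injective n m) j a

/-- `(x₁, …, xₘ₊ₙ) ↦ [α(x₁, …, xₘ), β(xₘ₊₁, …, xₘ₊ₙ)]`. -/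
def lieConcat {m n : ℕ}
    (α : MultilinearMap R (fun _ : Fin m => Derivation k R R) (freeLie k R))
    (β : MultilinearMap R (fun _ : Fin n => Derivation k R R) (freeLie k R)) :
    MultilinearMap R (fun _ : Fin (m + n) => Derivation k R R) (freeLie k R) :=
  MultilinearMap.mk'
    (fun x => ⁅α (fun i => x (Fin.castAdd n i)), β (fun j => x (Fin.natAdd m j))⁆)
    (fun x i a b => by
      refine Fin.addCases (fun j => ?_) (fun j => ?_) i
      · simp only [update_castAdd_left, update_castAdd_right, MultilinearMap.map_update_add, add_lie]
      · simp only [update_natAdd_left, update_natAdd_right, MultilinearMap.map_update_add, lie_add])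
    (fun x i c a => by
      refine Fin.addCases (fun j => ?_) (fun j => ?_) i
      · simp only [update_castAdd_left, update_castAdd_right, MultilinearMap.map_update_smul,
          smul_lie]
      · simp only [update_natAdd_left, update_natAdd_right, MultilinearMap.map_update_smul,
          lie_smul])

/-- Lie monomials: the multilinear maps `𝒱ⁿ → 𝔤` obtained by iterating Lie brackets, each of the
`n` variables occurring exactly once. -/
inductive IsLieMonomial :
    ∀ {n : ℕ}, MultilinearMap R (fun _ : Fin n => Derivation k R R) (freeLie k R) → Prop
  | id : IsLieMonomial ((incl k R).compMultilinearMap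
      (MultilinearMap.ofSubsingleton R _ _ (0 : Fin 1) LinearMap.id))
  | bracket {m n : ℕ} {α : MultilinearMap R (fun _ : Fin m => Derivation k R R) (freeLie k R)}
      {β : MultilinearMap R (fun _ : Fin n => Derivation k R R) (freeLie k R)} :
      IsLieMonomial α → IsLieMonomial β → IsLieMonomial (lieConcat α β)
  | perm {n : ℕ} {α : MultilinearMap R (fun _ : Fin n => Derivation k R R) (freeLie k R)}
      (σ : Equiv.Perm (Fin n)) : IsLieMonomial α → IsLieMonomial (α.domDomCongr σ)

/-- `t_α = -ρ ∘ α`. -/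
def tTensor (D : AffineConnection k R) {n : ℕ}
    (α : MultilinearMap R (fun _ : Fin n => Derivation k R R) (freeLie k R)) :
    MultilinearMap R (fun _ : Fin n => Derivation k R R) (Derivation k R R) :=
  -((rho D).compMultilinearMap α)

/-- `R_α(x₁, …, xₙ₊₁) = (α(x₁, …, xₙ) - ρ(α(x₁, …, xₙ))) ▷ xₙ₊₁`. -/
def rTensor (D : AffineConnection k R) {n : ℕ}
    (α : MultilinearMap R (fun _ : Fin n => Derivation k R R) (freeLie k R)) :
    MultilinearMap R (fun _ : Fin (n + 1) => Derivation k R R) (Derivation k R R) :=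
  MultilinearMap.uncurryRight ((curvAct D).compMultilinearMap α)

end

/-! ### The operad of multilinear maps and its suboperads -/

section

/-- The arity `n` component `𝒫ₙ(V)` of the operad of `k`-multilinear maps on `V`. -/
abbrev Poly (k : Type w) (V : Type u) [CommRing k] [AddCommGroup V] [Module k V] (n : ℕ) :=
  MultilinearMap k (fun _ : Fin n => V) V

variable {k : Type w} {V : Type u} [CommRing k] [AddCommGroup V] [Module k V]

/-- The unit of the operad. -/
def Poly.one : Poly k V 1 := MultilinearMap.ofSubsingleton k V V (0 : Fin 1) LinearMap.id

/-- The operadic composition `γ(φ; ψ₁, …, ψₙ)`, the variables of `ψ₁` coming first, then those of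
`ψ₂`, and so on. -/
def Poly.comp {n : ℕ} (φ : Poly k V n) {r : Fin n → ℕ} (ψ : ∀ i, Poly k V (r i)) :
    Poly k V (∑ i, r i) :=
  (φ.compMultilinearMap ψ).domDomCongr finSigmaFinEquiv

variable (k V) in
/-- A suboperad of the operad of multilinear maps on `V`. -/
@[ext]
structure Suboperad where
  carrier : ∀ n, Submodule k (Poly k V n)
  one_mem : Poly.one ∈ carrier 1
  perm_mem : ∀ {n : ℕ} (σ : Equiv.Perm (Fin n)) {φ : Poly k V n},
    φ ∈ carrier n → φ.domDomCongr σ ∈ carrier n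
  comp_mem : ∀ {n : ℕ} {φ : Poly k V n} {r : Fin n → ℕ} {ψ : ∀ i, Poly k V (r i)},
    φ ∈ carrier n → (∀ i, ψ i ∈ carrier (r i)) → φ.comp ψ ∈ carrier (∑ i, r i)

/-- The suboperad generated by a collection of multilinear maps: the smallest one containing it. -/
def Suboperad.generated (G : ∀ n, Set (Poly k V n)) : Suboperad k V where
  carrier n := ⨅ (O : Suboperad k V) (_ : ∀ m, G m ⊆ O.carrier m), O.carrier n
  one_mem := by
    simp only [Submodule.mem_iInf]
    exact fun O _ => O.one_mem
  perm_mem σ φ h := by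
    simp only [Submodule.mem_iInf] at h ⊢
    exact fun O hO => O.perm_mem σ (h O hO)
  comp_mem hφ hψ := by
    simp only [Submodule.mem_iInf] at hφ hψ ⊢
    exact fun O hO => O.comp_mem (hφ O hO) (fun i => hψ i O hO)

end

section

variable {k : Type w} {R : Type u} [CommRing k] [CommRing R] [Algebra k R]

/-- The covariant derivatives `∇ᵐt` and `∇ᵐR` of torsion and curvature. -/
inductive IsSpecialGenerator (D : AffineConnection k R) :
    ∀ n, Poly k (Derivation k R R) n → Prop
  | torsion (m : ℕ) :
      IsSpecialGenerator D (2 + m) ((iterCovDeriv D D (torsion D) m).restrictScalars k)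
  | curvature (m : ℕ) :
      IsSpecialGenerator D (3 + m) ((iterCovDeriv D D (curvature D) m).restrictScalars k)

/-- The covariant derivatives `∇ᵐt_α` and `∇ᵐR_α`, for `α` a Lie monomial. -/
inductive IsLieTypeGenerator (D : AffineConnection k R) :
    ∀ n, Poly k (Derivation k R R) n → Prop
  | torsion {n : ℕ} (α : MultilinearMap R (fun _ : Fin n => Derivation k R R) (freeLie k R))
      (hα : IsLieMonomial α) (m : ℕ) :
      IsLieTypeGenerator D (n + m) ((iterCovDeriv D D (tTensor D α) m).restrictScalars k)
  | curvature {n : ℕ} (α : MultilinearMap R (fun _ : Fin n => Derivation k R R) (freeLie k R))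
      (hα : IsLieMonomial α) (m : ℕ) :
      IsLieTypeGenerator D (n + 1 + m) ((iterCovDeriv D D (rTensor D α) m).restrictScalars k)

/-- The operad `𝒮(𝒱)` of special polynomials. -/
def specialPolynomials (D : AffineConnection k R) : Suboperad k (Derivation k R R) :=
  Suboperad.generated fun n => {φ | IsSpecialGenerator D n φ}

/-- The operad `𝒫_Lie(𝒱)` of polynomials of Lie type. -/
def lieTypePolynomials (D : AffineConnection k R) : Suboperad k (Derivation k R R) :=
  Suboperad.generated fun n => {φ | IsLieTypeGenerator D n φ}

end

end LiePoly

end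

/-!
The operads agree because the tensors `t_α` and `R_α` of a Lie monomial `α` can be computed from
torsion and curvature by recursion on `α`, and conversely torsion and curvature are the tensors of
the monomial `[x, y]`. Everything is algebraic and holds over any commutative algebra.

For one inclusion, `t = t_α` and `R = R_α` with `α = [x, y]` (`tTensor_bracket`, `rTensor_bracket`).

For the other, call a tensor special if it is built from the identity and the tensors `∇ᵐt`, `∇ᵐR`
by sums, relabelling of the variables and partial composition (`IsSpecialTensor`). Special tensors
are special polynomials (`IsSpecialTensor.mem_specialPolynomials`), and by the Leibniz rule for
partial composition (`covDeriv_subst`) they are closed under `∇` (`IsSpecialTensor.covDeriv`). So it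
is enough that `t_α` and `R_α` are special (`IsLieMonomial.isSpecialTensor`), without derivatives.

Let `u = α(x)` and `v = β(y)`. Elements of `𝔤` act by derivations, so
`⁅u, v⁆ ▷ s = u ▷ (v ▷ s) - v ▷ (u ▷ s) - (u ▷ v) ▷ s + (v ▷ u) ▷ s`, and `u ▷ v` is
`∑ⱼ β(…, u ▷ yⱼ, …)` (`act_lie`). On vector fields `u` acts as `∇_{ρ(u)}` plus the endomorphism
`R_α(x, ·)`; substituting this everywhere, the terms `∇_{ρ(u)} yⱼ` combine with the derivatives of
`t_β` and `R_β` to covariant derivatives of these tensors. For `φ = t_β` or `R_β`, put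
`L_u φ(w) = (∇φ)(t_α(x), w) + ∑ⱼ φ(…, R_α(x, wⱼ), …)` (`lieTerm`). Then
`t_{[α, β]} = t(t_α, t_β) - L_u t_β + L_v t_α` and
`R_{[α, β]} = R(t_α, t_β, ·) - L_u R_β + L_v R_α` (`tTensor_lieConcat`, `rTensor_lieConcat`),
and the right-hand sides are special if the tensors of `α` and `β` are.
-/

noncomputable section

namespace LiePoly

universe u v w

attribute [local instance] LieRing.ofAssociativeRing

/-! ### Partial composition of multilinear maps -/

section

variable {S : Type*} {V : Type*} [CommRing S] [AddCommGroup V] [Module S V]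

/-- The partial composition of `φ` with `ψ` in the slot `j`. The arguments of `ψ` are the variables
listed by `g`, the remaining arguments of `φ` are those listed by `f`, in this order; together `f`
and `g` list every variable once. -/
def subst {m n p : ℕ} (φ : MultilinearMap S (fun _ : Fin (n + 1) => V) V) (j : Fin (n + 1))
    (ψ : MultilinearMap S (fun _ : Fin m => V) V) (g : Fin m → Fin p) (f : Fin n → Fin p)
    (h : Function.Bijective (Sum.elim g f)) : MultilinearMap S (fun _ : Fin p => V) V :=
  (((φ.curryMid j).compMultilinearMap ψ).uncurrySum
    (N := fun _ : Fin m ⊕ Fin n => V)).domDomCongr (Equiv.ofBijective _ h)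

theorem subst_apply {m n p : ℕ} (φ : MultilinearMap S (fun _ : Fin (n + 1) => V) V)
    (j : Fin (n + 1)) (ψ : MultilinearMap S (fun _ : Fin m => V) V) (g : Fin m → Fin p)
    (f : Fin n → Fin p) (h : Function.Bijective (Sum.elim g f)) (x : Fin p → V) :
    subst φ j ψ g f h x = φ (j.insertNth (ψ (x ∘ g)) (x ∘ f)) :=
  rfl

end

theorem bijective_sumElim {m n p : ℕ} {g : Fin m → Fin p} {f : Fin n → Fin p}
    (hg : Function.Injective g) (hf : Function.Injective f) (hgf : ∀ i j, g i ≠ f j)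
    (hp : p = m + n) : Function.Bijective (Sum.elim g f) :=
  (Fintype.bijective_iff_injective_and_card _).2 ⟨hg.sumElim hf hgf, by simp [hp]⟩

theorem bijective_sumElim_iff {m n p : ℕ} {g : Fin m → Fin p} {f : Fin n → Fin p} :
    Function.Bijective (Sum.elim g f) ↔
      Function.Injective g ∧ Function.Injective f ∧ (∀ i j, g i ≠ f j) ∧ p = m + n := by
  refine ⟨fun h => ⟨fun a b hab => ?_, fun a b hab => ?_, fun i j hij => ?_, ?_⟩,
    fun h => bijective_sumElim h.1 h.2.1 h.2.2.1 h.2.2.2⟩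
  · exact Sum.inl_injective (h.1 (by simpa using hab))
  · exact Sum.inr_injective (h.1 (by simpa using hab))
  · simpa using h.1 (show Sum.elim g f (Sum.inl i) = Sum.elim g f (Sum.inr j) from hij)
  · simpa using (Fintype.card_of_bijective h).symm

theorem bijective_sumElim_cons_right {m n p : ℕ} {g : Fin m → Fin p} {f : Fin n → Fin p}
    (h : Function.Bijective (Sum.elim g f)) :
    Function.Bijective (Sum.elim (Fin.succ ∘ g)
      (Fin.cons 0 (Fin.succ ∘ f) : Fin (n + 1) → Fin (p + 1))) := by
  obtain ⟨h1, h2, h3, h4⟩ := bijective_sumElim_iff.1 h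
  refine bijective_sumElim ((Fin.succ_injective _).comp h1) ?_ ?_ (by omega)
  · rw [Fin.cons_injective_iff]
    exact ⟨by simp, (Fin.succ_injective _).comp h2⟩
  · intro i j
    refine Fin.cases ?_ (fun j => ?_) j
    · simp
    · simpa using h3 i j

theorem bijective_sumElim_cons_left {m n p : ℕ} {g : Fin m → Fin p} {f : Fin n → Fin p}
    (h : Function.Bijective (Sum.elim g f)) :
    Function.Bijective (Sum.elim
      (Fin.cons 0 (Fin.succ ∘ g) : Fin (m + 1) → Fin (p + 1)) (Fin.succ ∘ f)) := by
  obtain ⟨h1, h2, h3, h4⟩ := bijective_sumElim_iff.1 h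
  refine bijective_sumElim ?_ ((Fin.succ_injective _).comp h2) ?_ (by omega)
  · rw [Fin.cons_injective_iff]
    exact ⟨by simp, (Fin.succ_injective _).comp h1⟩
  · intro i j
    refine Fin.cases ?_ (fun i => ?_) i
    · simp [(Fin.succ_ne_zero _).symm]
    · simpa using h3 i j

section

variable {k : Type w} {R : Type u} [CommRing k] [CommRing R] [Algebra k R]

/-- The Leibniz rule for the covariant derivative of a partial composition. -/
theorem covDeriv_subst (D : AffineConnection k R) {m n p : ℕ}
    (φ : MultilinearMap R (fun _ : Fin (n + 1) => Derivation k R R) (Derivation k R R))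
    (j : Fin (n + 1))
    (ψ : MultilinearMap R (fun _ : Fin m => Derivation k R R) (Derivation k R R))
    (g : Fin m → Fin p) (f : Fin n → Fin p) (h : Function.Bijective (Sum.elim g f)) :
    covDeriv D D (subst φ j ψ g f h) =
      subst (covDeriv D D φ) j.succ ψ (Fin.succ ∘ g) (Fin.cons 0 (Fin.succ ∘ f))
        (bijective_sumElim_cons_right h) +
      subst φ j (covDeriv D D ψ) (Fin.cons 0 (Fin.succ ∘ g)) (Fin.succ ∘ f)
        (bijective_sumElim_cons_left h) := by
  obtain ⟨h1, h2, h3, h4⟩ := bijective_sumElim_iff.1 h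
  ext1 x
  obtain ⟨a, y, rfl⟩ : ∃ a y, x = Fin.cons a y := ⟨x 0, Fin.tail x, (Fin.cons_self_tail x).symm⟩
  have hcons : ∀ {q : ℕ} (e : Fin q → Fin p),
      (Fin.cons a y : Fin (p + 1) → Derivation k R R) ∘ (Fin.succ ∘ e) = y ∘ e := fun e => by
    ext1 i; simp
  have hcons' : ∀ {q : ℕ} (e : Fin q → Fin p),
      (Fin.cons a y : Fin (p + 1) → Derivation k R R) ∘
        (Fin.cons 0 (Fin.succ ∘ e) : Fin (q + 1) → Fin (p + 1)) = Fin.cons a (y ∘ e) := fun e => by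
    ext1 i; refine Fin.cases ?_ (fun i => ?_) i <;> simp
  rw [_root_.add_apply]
  simp only [subst_apply, covDeriv_apply, hcons, hcons', Fin.insertNth_succ_cons, Fin.cons_zero,
    Fin.tail_cons]
  rw [← (Equiv.ofBijective _ h).sum_comp, Fintype.sum_sum_type, Fin.sum_univ_succAbove _ j]
  have hl : ∀ i b, φ (j.insertNth (ψ (Function.update y (g i) b ∘ g))
      (Function.update y (g i) b ∘ f)) =
      φ (j.insertNth (ψ (Function.update (y ∘ g) i b)) (y ∘ f)) := fun i b => by
    rw [Function.update_comp_eq_of_injective y h1,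
      Function.update_comp_eq_of_forall_ne y b (fun l => (h3 i l).symm)]
  have hr : ∀ i b, φ (j.insertNth (ψ (Function.update y (f i) b ∘ g))
      (Function.update y (f i) b ∘ f)) =
      φ (j.insertNth (ψ (y ∘ g)) (Function.update (y ∘ f) i b)) := fun i b => by
    rw [Function.update_comp_eq_of_injective y h2,
      Function.update_comp_eq_of_forall_ne y b (fun l => h3 l i)]
  have hφ : ∀ b, φ (j.insertNth b (y ∘ f)) = φ.curryMid j b (y ∘ f) := fun b => rfl
  simp only [Equiv.ofBijective_apply, Sum.elim_inl, Sum.elim_inr, hl, hr, Fin.insertNth_update,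
    Fin.insertNth_apply_same, Fin.insertNth_apply_succAbove, Fin.update_insertNth]
  simp only [hφ, map_sub, map_sum, _root_.sub_apply, _root_.sum_apply,
    Function.comp_apply]
  abel

theorem covDeriv_relabel (D : AffineConnection k R) {n p : ℕ}
    (φ : MultilinearMap R (fun _ : Fin n => Derivation k R R) (Derivation k R R))
    (χ : MultilinearMap R (fun _ : Fin p => Derivation k R R) (Derivation k R R))
    (f : Fin n → Fin p) (hf : Function.Bijective f) (h : ∀ x, χ x = φ (x ∘ f))
    (x : Fin (p + 1) → Derivation k R R) :
    covDeriv D D χ x = covDeriv D D φ (x ∘ (Fin.cons 0 (Fin.succ ∘ f) : Fin (n + 1) → _)) := by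
  simp only [covDeriv_apply, h, ← (Equiv.ofBijective f hf).sum_comp, Equiv.ofBijective_apply,
    Function.update_comp_eq_of_injective _ hf.1]
  rfl

theorem covDeriv_add (D : AffineConnection k R) {n : ℕ}
    (φ ψ : MultilinearMap R (fun _ : Fin n => Derivation k R R) (Derivation k R R)) :
    covDeriv D D (φ + ψ) = covDeriv D D φ + covDeriv D D ψ := by
  ext1 x
  simp only [covDeriv_apply, _root_.add_apply, map_add, Finset.sum_add_distrib]
  abel

theorem covDeriv_neg (D : AffineConnection k R) {n : ℕ}
    (φ : MultilinearMap R (fun _ : Fin n => Derivation k R R) (Derivation k R R)) :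
    covDeriv D D (-φ) = -covDeriv D D φ := by
  ext1 x
  simp only [covDeriv_apply, _root_.neg_apply, map_neg, Finset.sum_neg_distrib]
  abel

theorem covDeriv_zero (D : AffineConnection k R) (n : ℕ) :
    covDeriv D D (0 : MultilinearMap R (fun _ : Fin n => Derivation k R R) (Derivation k R R)) =
      0 := by
  ext1 x
  simp [covDeriv_apply]

/-- The identity of `𝒱` as a tensor with one argument. -/
abbrev idTensor (k : Type w) (R : Type u) [CommRing k] [CommRing R] [Algebra k R] :
    MultilinearMap R (fun _ : Fin 1 => Derivation k R R) (Derivation k R R) :=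
  MultilinearMap.ofSubsingleton R _ _ (0 : Fin 1) LinearMap.id

theorem covDeriv_idTensor (D : AffineConnection k R) : covDeriv D D (idTensor k R) = 0 := by
  ext1 x
  simp [covDeriv_apply, Fin.tail]

/-! ### Special tensors -/

/-- The `R`-multilinear maps obtained from the identity and the covariant derivatives of torsion and
curvature by sums, relabelling of variables, and partial composition. A relabelling is given by a
bijection `Fin n → Fin p` rather than a permutation, so that `n = p` need only hold propositionally. -/
inductive IsSpecialTensor (D : AffineConnection k R) :
    ∀ {n : ℕ}, MultilinearMap R (fun _ : Fin n => Derivation k R R) (Derivation k R R) → Prop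
  | torsion (m : ℕ) : IsSpecialTensor D (iterCovDeriv D D (torsion D) m)
  | curvature (m : ℕ) : IsSpecialTensor D (iterCovDeriv D D (curvature D) m)
  | id : IsSpecialTensor D (idTensor k R)
  | zero (n : ℕ) : IsSpecialTensor D
      (0 : MultilinearMap R (fun _ : Fin n => Derivation k R R) (Derivation k R R))
  | add {n : ℕ} {φ ψ : MultilinearMap R (fun _ : Fin n => Derivation k R R) (Derivation k R R)} :
      IsSpecialTensor D φ → IsSpecialTensor D ψ → IsSpecialTensor D (φ + ψ)
  | neg {n : ℕ} {φ : MultilinearMap R (fun _ : Fin n => Derivation k R R) (Derivation k R R)} :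
      IsSpecialTensor D φ → IsSpecialTensor D (-φ)
  | relabel {n p : ℕ}
      {φ : MultilinearMap R (fun _ : Fin n => Derivation k R R) (Derivation k R R)}
      {χ : MultilinearMap R (fun _ : Fin p => Derivation k R R) (Derivation k R R)}
      (hφ : IsSpecialTensor D φ) (f : Fin n → Fin p) (hf : Function.Bijective f)
      (h : ∀ x, χ x = φ (x ∘ f)) : IsSpecialTensor D χ
  | subst {m n p : ℕ}
      {φ : MultilinearMap R (fun _ : Fin (n + 1) => Derivation k R R) (Derivation k R R)}
      {ψ : MultilinearMap R (fun _ : Fin m => Derivation k R R) (Derivation k R R)}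
      (hφ : IsSpecialTensor D φ) (hψ : IsSpecialTensor D ψ) (j : Fin (n + 1))
      (g : Fin m → Fin p) (f : Fin n → Fin p) (h : Function.Bijective (Sum.elim g f)) :
      IsSpecialTensor D (subst φ j ψ g f h)

namespace IsSpecialTensor

variable {D : AffineConnection k R}

theorem covDeriv {n : ℕ}
    {φ : MultilinearMap R (fun _ : Fin n => Derivation k R R) (Derivation k R R)}
    (hφ : IsSpecialTensor D φ) : IsSpecialTensor D (covDeriv D D φ) := by
  induction hφ with
  | torsion m => exact .torsion (m + 1)
  | curvature m => exact .curvature (m + 1)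
  | id => rw [covDeriv_idTensor]; exact .zero 2
  | zero n => rw [covDeriv_zero]; exact .zero _
  | add _ _ ih1 ih2 => rw [covDeriv_add]; exact ih1.add ih2
  | neg _ ih => rw [covDeriv_neg]; exact ih.neg
  | @relabel n p φ χ _ f hf h ih =>
    refine ih.relabel (Fin.cons 0 (Fin.succ ∘ f)) ?_ (covDeriv_relabel D φ χ f hf h)
    have hnp : n = p := by simpa using Fintype.card_of_bijective hf
    refine (Fintype.bijective_iff_injective_and_card _).2 ⟨?_, by simp [hnp]⟩
    rw [Fin.cons_injective_iff]
    exact ⟨by simp, (Fin.succ_injective _).comp hf.1⟩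
  | subst h1 h2 j g f h ih1 ih2 =>
    rw [covDeriv_subst]
    exact (ih1.subst h2 _ _ _ _).add (h1.subst ih2 _ _ _ _)

theorem iterCovDeriv {n : ℕ}
    {φ : MultilinearMap R (fun _ : Fin n => Derivation k R R) (Derivation k R R)}
    (hφ : IsSpecialTensor D φ) : ∀ m : ℕ, IsSpecialTensor D (iterCovDeriv D D φ m)
  | 0 => hφ
  | m + 1 => (iterCovDeriv hφ m).covDeriv

/-- A finite sum of special tensors that are given as functions is a special tensor. -/
theorem exists_sum {n : ℕ} {ι : Type*} (s : Finset ι)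
    {F : ι → (Fin n → Derivation k R R) → Derivation k R R}
    (hF : ∀ i, ∃ φ : MultilinearMap R (fun _ : Fin n => Derivation k R R) (Derivation k R R),
      IsSpecialTensor D φ ∧ ∀ x, φ x = F i x) :
    ∃ φ : MultilinearMap R (fun _ : Fin n => Derivation k R R) (Derivation k R R),
      IsSpecialTensor D φ ∧ ∀ x, φ x = ∑ i ∈ s, F i x := by
  classical
  induction s using Finset.induction_on with
  | empty => exact ⟨0, .zero n, fun x => by simp⟩
  | insert a s ha ih =>
    obtain ⟨φ, h1, h2⟩ := ih
    obtain ⟨ψ, h3, h4⟩ := hF a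
    exact ⟨ψ + φ, h3.add h1, fun x => by simp [Finset.sum_insert ha, h2, h4]⟩

end IsSpecialTensor

end

/-! ### Suboperads are closed under partial composition -/

section

variable {k : Type w} {V : Type u} [CommRing k] [AddCommGroup V] [Module k V]

theorem Suboperad.relabel_mem (O : Suboperad k V) {n p : ℕ} {φ : Poly k V n} (hφ : φ ∈ O.carrier n)
    {χ : Poly k V p} (f : Fin n → Fin p) (hf : Function.Bijective f) (h : ∀ x, χ x = φ (x ∘ f)) :
    χ ∈ O.carrier p := by
  have hnp : n = p := by simpa using Fintype.card_of_bijective hf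
  subst hnp
  have : χ = φ.domDomCongr (Equiv.ofBijective f hf) := by
    ext1 x
    rw [h]
    rfl
  rw [this]
  exact O.perm_mem _ hφ

/-- Partial composition is the full composition with identities in all other slots. -/
theorem Suboperad.subst_mem (O : Suboperad k V) {m n p : ℕ} {φ : Poly k V (n + 1)}
    (hφ : φ ∈ O.carrier (n + 1)) {ψ : Poly k V m} (hψ : ψ ∈ O.carrier m) (j : Fin (n + 1))
    (g : Fin m → Fin p) (f : Fin n → Fin p) (h : Function.Bijective (Sum.elim g f)) :
    subst φ j ψ g f h ∈ O.carrier p := by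
  -- moving the slot `j` to the front makes the arity of the inserted map definitionally `m`
  have hφ' := O.perm_mem j.cycleRange hφ
  let r : Fin (n + 1) → ℕ := Fin.cons m fun _ => 1
  let ψ' : ∀ i, Poly k V (r i) := Fin.cons (α := fun i => Poly k V (r i)) ψ fun _ => Poly.one
  have hψ' : ∀ i, ψ' i ∈ O.carrier (r i) := Fin.cases hψ fun _ => O.one_mem
  let T : (Σ i, Fin (r i)) → Fin p := fun s =>
    Fin.cases (motive := fun i => Fin (r i) → Fin p) g (fun i _ => f i) s.1 s.2
  have hT : Function.Bijective T := by
    constructor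
    · rintro ⟨i, a⟩ ⟨i', a'⟩ hs
      obtain ⟨h1, h2, h3, -⟩ := bijective_sumElim_iff.1 h
      induction i using Fin.cases with
      | zero =>
        induction i' using Fin.cases with
        | zero => rw [h1 (show g a = g a' from hs)]
        | succ i' => exact absurd hs (h3 a i')
      | succ i =>
        induction i' using Fin.cases with
        | zero => exact absurd hs.symm (h3 a' i)
        | succ i' =>
          obtain rfl : i = i' := h2 hs
          rw [show a = a' from Subsingleton.elim (α := Fin 1) a a']
    · intro q
      obtain ⟨a | a, ha⟩ := h.2 q
      · exact ⟨⟨0, a⟩, ha⟩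
      · exact ⟨⟨a.succ, (0 : Fin 1)⟩, ha⟩
  refine O.relabel_mem (O.comp_mem hφ' hψ') (T ∘ finSigmaFinEquiv.symm)
    (hT.comp finSigmaFinEquiv.symm.bijective) fun x => ?_
  have hx : ∀ i, ψ' i (fun l => x (T (finSigmaFinEquiv.symm (finSigmaFinEquiv ⟨i, l⟩)))) =
      (Fin.cons (ψ (x ∘ g)) (x ∘ f) : Fin (n + 1) → V) i := by
    simp only [Equiv.symm_apply_apply]
    exact Fin.cases rfl fun i => rfl
  rw [subst_apply, ← Fin.cons_comp_cycleRange, ← funext hx]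
  rfl

theorem Suboperad.subset_generated (G : ∀ n, Set (Poly k V n)) (n : ℕ) :
    G n ⊆ (Suboperad.generated G).carrier n := by
  intro φ hφ
  simp only [Suboperad.generated, SetLike.mem_coe, Submodule.mem_iInf]
  exact fun O hO => hO n hφ

theorem Suboperad.generated_le {G : ∀ n, Set (Poly k V n)} (O : Suboperad k V)
    (h : ∀ n, G n ⊆ O.carrier n) (n : ℕ) : (Suboperad.generated G).carrier n ≤ O.carrier n := by
  intro φ hφ
  simp only [Suboperad.generated, Submodule.mem_iInf] at hφ
  exact hφ O h

end

section

variable {k : Type w} {R : Type u} [CommRing k] [CommRing R] [Algebra k R]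

theorem IsSpecialTensor.mem_specialPolynomials {D : AffineConnection k R} {n : ℕ}
    {φ : MultilinearMap R (fun _ : Fin n => Derivation k R R) (Derivation k R R)}
    (hφ : IsSpecialTensor D φ) : φ.restrictScalars k ∈ (specialPolynomials D).carrier n := by
  induction hφ with
  | torsion m => exact Suboperad.subset_generated _ _ (IsSpecialGenerator.torsion m)
  | curvature m => exact Suboperad.subset_generated _ _ (IsSpecialGenerator.curvature m)
  | id => exact (specialPolynomials D).one_mem
  | zero n => exact zero_mem _
  | add _ _ ih1 ih2 => exact add_mem ih1 ih2
  | neg _ ih => exact neg_mem ih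
  | relabel _ f hf h ih => exact Suboperad.relabel_mem _ ih f hf h
  | subst _ _ j g f h ih1 ih2 => exact Suboperad.subst_mem _ ih1 ih2 j g f h

end

/-! ### The action of a bracket of two Lie monomials -/

section

variable {k : Type w} {R : Type u} [CommRing k] [CommRing R] [Algebra k R]

theorem lieConcat_apply {m n : ℕ}
    (α : MultilinearMap R (fun _ : Fin m => Derivation k R R) (freeLie k R))
    (β : MultilinearMap R (fun _ : Fin n => Derivation k R R) (freeLie k R))
    (x : Fin (m + n) → Derivation k R R) :
    lieConcat α β x = ⁅α (fun i => x (Fin.castAdd n i)), β (fun j => x (Fin.natAdd m j))⁆ := by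
  simp only [lieConcat, MultilinearMap.mk'_apply]

theorem tTensor_apply (D : AffineConnection k R) {n : ℕ}
    (α : MultilinearMap R (fun _ : Fin n => Derivation k R R) (freeLie k R))
    (x : Fin n → Derivation k R R) : tTensor D α x = -rho D (α x) :=
  rfl

theorem rTensor_snoc (D : AffineConnection k R) {n : ℕ}
    (α : MultilinearMap R (fun _ : Fin n => Derivation k R R) (freeLie k R))
    (x : Fin n → Derivation k R R) (z : Derivation k R R) :
    rTensor D α (Fin.snoc x z) = curvAct D (α x) z := by
  simp only [rTensor, MultilinearMap.uncurryRight_apply, Fin.init_snoc, Fin.snoc_last]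
  rfl

theorem torsion_apply (D : AffineConnection k R) (x : Fin 2 → Derivation k R R) :
    torsion D x = D.nabla (x 0) (x 1) - D.nabla (x 1) (x 0) - ⁅x 0, x 1⁆ := by
  simp only [torsion, MultilinearMap.mk'_apply]

theorem curvature_apply (D : AffineConnection k R) (x : Fin 3 → Derivation k R R) :
    curvature D x = D.nabla (x 0) (D.nabla (x 1) (x 2)) - D.nabla (x 1) (D.nabla (x 0) (x 2)) -
      D.nabla ⁅x 0, x 1⁆ (x 2) := by
  simp only [curvature, MultilinearMap.mk'_apply]

/-- The splitting `u = ρ(u) + (u - ρ(u))` of the action of `u ∈ 𝔤` on vector fields. -/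
theorem act_eq_nabla_add_curvAct (D : AffineConnection k R) (u : freeLie k R)
    (z : Derivation k R R) :
    act D D (u : TAlg k R) z = D.nabla (rho D u) z + curvAct D u z := by
  have h : curvAct D u z = act D D ((u : TAlg k R) - TensorAlgebra.ι R (rho D u)) z := rfl
  rw [h, map_sub, LinearMap.sub_apply, act_ι]
  abel

/-- A derivation of `𝒜` that preserves `𝒱` acts on the value of a Lie monomial by the Leibniz
rule. -/
theorem IsLieMonomial.derivation_apply {n : ℕ}
    {α : MultilinearMap R (fun _ : Fin n => Derivation k R R) (freeLie k R)}
    (hα : IsLieMonomial α) (δ : TAlg k R →+ TAlg k R) (hmul : ∀ a b, δ (a * b) = δ a * b + a * δ b)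
    (h : Derivation k R R → Derivation k R R)
    (hι : ∀ y, δ (TensorAlgebra.ι R y) = TensorAlgebra.ι R (h y)) (x : Fin n → Derivation k R R) :
    δ (α x : TAlg k R) = ∑ j, (α (Function.update x j (h (x j))) : TAlg k R) := by
  induction hα with
  | id => exact (hι (x 0)).trans (by rw [Fin.sum_univ_one]; exact congrArg _ (by simp))
  | @bracket m n α β _ _ ih1 ih2 =>
    have hδ : ∀ a b : TAlg k R, δ ⁅a, b⁆ = ⁅δ a, b⁆ + ⁅a, δ b⁆ := fun a b => by
      simp only [LieRing.of_associative_ring_bracket, map_sub, hmul]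
      abel
    simp only [lieConcat_apply, LieSubalgebra.coe_bracket, hδ, ih1, ih2, Fin.sum_univ_add,
      update_castAdd_left, update_castAdd_right, update_natAdd_left, update_natAdd_right,
      sum_lie, lie_sum]
  | @perm n α σ _ ih =>
    simp only [MultilinearMap.domDomCongr_apply, ih]
    refine Fintype.sum_equiv σ _ _ fun i => ?_
    congr 2
    exact (Function.update_comp_eq_of_injective x σ.injective i _).symm

/-- `⁅u, v⁆ ▷ s = u ▷ (v ▷ s) - v ▷ (u ▷ s) - (u ▷ v) ▷ s + (v ▷ u) ▷ s` for `u = α(x)` and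
`v = β(y)`, where `u ▷ v` is expanded by the Leibniz rule. -/
theorem act_lie (D : AffineConnection k R) {m n : ℕ}
    {α : MultilinearMap R (fun _ : Fin m => Derivation k R R) (freeLie k R)}
    {β : MultilinearMap R (fun _ : Fin n => Derivation k R R) (freeLie k R)}
    (hα : IsLieMonomial α) (hβ : IsLieMonomial β) (x : Fin m → Derivation k R R)
    (y : Fin n → Derivation k R R) {N : Type u} [AddCommGroup N] [Module k N]
    [Module R N] [IsScalarTower k R N] (E : Connection k R N) (s : N) :
    act D E (⁅α x, β y⁆ : freeLie k R) s =
      act D E (α x) (act D E (β y) s) - act D E (β y) (act D E (α x) s) -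
      act D E (∑ j, β (Function.update y j (act D D (α x) (y j))) : freeLie k R) s +
      act D E (∑ i, α (Function.update x i (act D D (β y) (x i))) : freeLie k R) s := by
  obtain ⟨δ, h1, h2, -, h4⟩ := freeLie_mem_derivationActing D (α x).2
  obtain ⟨ε, g1, g2, -, g4⟩ := freeLie_mem_derivationActing D (β y).2
  rw [LieSubalgebra.coe_bracket, LieRing.of_associative_ring_bracket, map_sub,
    LinearMap.sub_apply, (h4 N E).1, (g4 N E).1, hβ.derivation_apply δ h1 _ h2,
    hα.derivation_apply ε g1 _ g2]
  simp only [AddSubmonoidClass.coe_finsetSum]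
  abel

theorem rho_lie (D : AffineConnection k R) {m n : ℕ}
    {α : MultilinearMap R (fun _ : Fin m => Derivation k R R) (freeLie k R)}
    {β : MultilinearMap R (fun _ : Fin n => Derivation k R R) (freeLie k R)}
    (hα : IsLieMonomial α) (hβ : IsLieMonomial β) (x : Fin m → Derivation k R R)
    (y : Fin n → Derivation k R R) :
    rho D ⁅α x, β y⁆ = ⁅rho D (α x), rho D (β y)⁆ -
      ∑ j, rho D (β (Function.update y j (act D D (α x) (y j)))) +
      ∑ i, rho D (α (Function.update x i (act D D (β y) (x i)))) := by
  rw [← map_sum (rho D), ← map_sum (rho D)]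
  ext f
  rw [Derivation.add_apply, Derivation.sub_apply, Derivation.commutator_apply]
  exact act_lie D hα hβ x y (Connection.fn k R) f

/-- The action of `⁅u, v⁆ - ρ(⁅u, v⁆)` on vector fields: the vector fields `ρ(u ▷ v)` and
`ρ(v ▷ u)` occurring in `rho_lie` cancel. -/
theorem curvAct_lie (D : AffineConnection k R) {m n : ℕ}
    {α : MultilinearMap R (fun _ : Fin m => Derivation k R R) (freeLie k R)}
    {β : MultilinearMap R (fun _ : Fin n => Derivation k R R) (freeLie k R)}
    (hα : IsLieMonomial α) (hβ : IsLieMonomial β) (x : Fin m → Derivation k R R)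
    (y : Fin n → Derivation k R R) (z : Derivation k R R) :
    curvAct D ⁅α x, β y⁆ z =
      act D D (α x) (act D D (β y) z) - act D D (β y) (act D D (α x) z) -
      D.nabla ⁅rho D (α x), rho D (β y)⁆ z -
      ∑ j, curvAct D (β (Function.update y j (act D D (α x) (y j)))) z +
      ∑ i, curvAct D (α (Function.update x i (act D D (β y) (x i)))) z := by
  have h := act_lie D hα hβ x y D z
  rw [act_eq_nabla_add_curvAct, act_eq_nabla_add_curvAct D (∑ j, _),
    act_eq_nabla_add_curvAct D (∑ j, _), rho_lie D hα hβ] at h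
  simp only [map_sum, map_add, map_sub, LinearMap.add_apply, LinearMap.sub_apply,
    LinearMap.sum_apply] at h ⊢
  rw [← eq_sub_iff_add_eq'] at h
  rw [h]
  abel

/-! ### The tensors of a bracket of two Lie monomials -/

/-- The expression `(∇φ)(τ, w) + ∑ⱼ φ(…, κ(wⱼ), …)`. For `τ = -ρ(u)` and `κ = u - ρ(u)`, where
`u ∈ 𝔤`, it is `∑ⱼ φ(…, u ▷ wⱼ, …) - ρ(u) ▷ φ(w)`, see `lieTerm_eq`. -/
def lieTerm (D : AffineConnection k R) {n : ℕ}
    (φ : MultilinearMap R (fun _ : Fin n => Derivation k R R) (Derivation k R R))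
    (τ : Derivation k R R) (κ : Derivation k R R → Derivation k R R)
    (w : Fin n → Derivation k R R) : Derivation k R R :=
  covDeriv D D φ (Fin.cons τ w) + ∑ j, φ (Function.update w j (κ (w j)))

theorem lieTerm_eq (D : AffineConnection k R) {n : ℕ}
    (φ : MultilinearMap R (fun _ : Fin n => Derivation k R R) (Derivation k R R))
    (u : freeLie k R) (w : Fin n → Derivation k R R) :
    lieTerm D φ (-rho D u) (curvAct D u) w =
      ∑ j, φ (Function.update w j (act D D u (w j))) - D.nabla (rho D u) (φ w) := by
  simp only [lieTerm, covDeriv_apply, Fin.cons_zero, Fin.tail_cons, act_eq_nabla_add_curvAct,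
    MultilinearMap.map_update_add, Finset.sum_add_distrib, map_neg, LinearMap.neg_apply,
    MultilinearMap.map_update_neg, Finset.sum_neg_distrib]
  abel

theorem tTensor_lieConcat (D : AffineConnection k R) {m n : ℕ}
    {α : MultilinearMap R (fun _ : Fin m => Derivation k R R) (freeLie k R)}
    {β : MultilinearMap R (fun _ : Fin n => Derivation k R R) (freeLie k R)}
    (hα : IsLieMonomial α) (hβ : IsLieMonomial β) (x : Fin m → Derivation k R R)
    (y : Fin n → Derivation k R R) :
    tTensor D (lieConcat α β) (Fin.append x y) =
      torsion D ![tTensor D α x, tTensor D β y] -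
      lieTerm D (tTensor D β) (tTensor D α x) (fun z => rTensor D α (Fin.snoc x z)) y +
      lieTerm D (tTensor D α) (tTensor D β y) (fun z => rTensor D β (Fin.snoc y z)) x := by
  simp only [rTensor_snoc, tTensor_apply D α x, tTensor_apply D β y, lieTerm_eq]
  simp only [tTensor_apply, lieConcat_apply, Fin.append_left, Fin.append_right, rho_lie D hα hβ,
    torsion_apply]
  simp
  abel

theorem rTensor_lieConcat (D : AffineConnection k R) {m n : ℕ}
    {α : MultilinearMap R (fun _ : Fin m => Derivation k R R) (freeLie k R)}
    {β : MultilinearMap R (fun _ : Fin n => Derivation k R R) (freeLie k R)}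
    (hα : IsLieMonomial α) (hβ : IsLieMonomial β) (x : Fin m → Derivation k R R)
    (y : Fin n → Derivation k R R) (z : Derivation k R R) :
    rTensor D (lieConcat α β) (Fin.snoc (Fin.append x y) z) =
      curvature D ![tTensor D α x, tTensor D β y, z] -
      lieTerm D (rTensor D β) (tTensor D α x) (fun z => rTensor D α (Fin.snoc x z))
        (Fin.snoc y z) +
      lieTerm D (rTensor D α) (tTensor D β y) (fun z => rTensor D β (Fin.snoc y z))
        (Fin.snoc x z) := by
  simp only [rTensor_snoc, tTensor_apply D α x, tTensor_apply D β y, lieTerm_eq,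
    Fin.sum_univ_castSucc, ← Fin.snoc_update, Fin.snoc_castSucc, Fin.snoc_last, Fin.update_snoc_last]
  simp only [lieConcat_apply, Fin.append_left, Fin.append_right, curvAct_lie D hα hβ,
    curvature_apply, act_eq_nabla_add_curvAct D _ z]
  simp [act_eq_nabla_add_curvAct]
  abel

end

section

variable {k : Type w} {R : Type u} [CommRing k] [CommRing R] [Algebra k R]

/-! ### Lists of variables -/

theorem snoc_append_comp_natAdd {V : Type*} {m n : ℕ} (x : Fin m → V) (y : Fin n → V) (z : V) :
    (Fin.snoc (Fin.append x y) z : Fin (m + n + 1) → V) ∘ (Fin.castSucc ∘ Fin.natAdd m) = y :=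
  funext fun i => (Fin.snoc_castSucc (α := fun _ => V) _ _ _).trans (Fin.append_right x y i)

theorem snoc_append_comp_snoc {V : Type*} {m n : ℕ} (x : Fin m → V) (y : Fin n → V) (z : V) :
    (Fin.snoc (Fin.append x y) z : Fin (m + n + 1) → V) ∘
      (Fin.snoc (Fin.castSucc ∘ Fin.castAdd n) (Fin.last (m + n)) : Fin (m + 1) → _) =
      Fin.snoc x z := by
  rw [Fin.comp_snoc, Fin.snoc_last]
  congr 1
  exact funext fun i => (Fin.snoc_castSucc (α := fun _ => V) _ _ _).trans (Fin.append_left x y i)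

/-- The variables `m, …, m + n - 1` and `0, …, m - 1, m + n` among `m + n + 1` variables are
disjoint. -/
theorem disjoint_castSucc_natAdd_snoc (m n : ℕ) :
    Function.Injective (Fin.castSucc ∘ Fin.natAdd m : Fin n → Fin (m + n + 1)) ∧
      Function.Injective
        (Fin.snoc (Fin.castSucc ∘ Fin.castAdd n) (Fin.last (m + n)) : Fin (m + 1) → _) ∧
      ∀ (i : Fin n) (j : Fin (m + 1)), (Fin.castSucc ∘ Fin.natAdd m) i ≠
        (Fin.snoc (Fin.castSucc ∘ Fin.castAdd n) (Fin.last (m + n)) : Fin (m + 1) → _) j := by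
  refine ⟨(Fin.castSucc_injective _).comp (Fin.natAdd_injective _ _), ?_, fun i j => ?_⟩
  · rw [Fin.snoc_injective_iff]
    refine ⟨(Fin.castSucc_injective _).comp (Fin.castAdd_injective _ _), ?_⟩
    rintro ⟨i, hi⟩
    exact Fin.castSucc_ne_last _ hi
  · refine Fin.lastCases ?_ (fun j => ?_) j
    · rw [Fin.snoc_last]
      exact Fin.castSucc_ne_last _
    · simp only [Fin.snoc_castSucc, ne_eq, Fin.ext_iff, Function.comp_apply, Fin.val_castSucc,
        Fin.val_castAdd, Fin.val_natAdd]
      omega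

theorem comp_append {V W : Type*} {m n : ℕ} (F : V → W) (x : Fin m → V) (y : Fin n → V) :
    F ∘ Fin.append x y = Fin.append (F ∘ x) (F ∘ y) :=
  funext fun i => Fin.addCases (fun i => by simp) (fun i => by simp) i

/-! ### The tensors of Lie monomials are special -/

namespace IsSpecialTensor

variable {D : AffineConnection k R}

theorem exists_relabel {n p : ℕ}
    {φ : MultilinearMap R (fun _ : Fin n => Derivation k R R) (Derivation k R R)}
    (hφ : IsSpecialTensor D φ) (f : Fin n → Fin p) (hf : Function.Injective f) (hnp : n = p) :
    ∃ χ : MultilinearMap R (fun _ : Fin p => Derivation k R R) (Derivation k R R),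
      IsSpecialTensor D χ ∧ ∀ x, χ x = φ (x ∘ f) := by
  have hf' : Function.Bijective f :=
    (Fintype.bijective_iff_injective_and_card _).2 ⟨hf, by simp [hnp]⟩
  exact ⟨φ.domDomCongr (Equiv.ofBijective f hf'), hφ.relabel f hf' fun x => rfl, fun x => rfl⟩

theorem exists_subst {m n p : ℕ}
    {φ : MultilinearMap R (fun _ : Fin (n + 1) => Derivation k R R) (Derivation k R R)}
    {ψ : MultilinearMap R (fun _ : Fin m => Derivation k R R) (Derivation k R R)}
    (hφ : IsSpecialTensor D φ) (hψ : IsSpecialTensor D ψ) (j : Fin (n + 1))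
    (g : Fin m → Fin p) (f : Fin n → Fin p) (hg : Function.Injective g)
    (hf : Function.Injective f) (hgf : ∀ i j, g i ≠ f j) (hp : p = m + n) :
    ∃ χ : MultilinearMap R (fun _ : Fin p => Derivation k R R) (Derivation k R R),
      IsSpecialTensor D χ ∧ ∀ x, χ x = φ (j.insertNth (ψ (x ∘ g)) (x ∘ f)) :=
  ⟨_, hφ.subst hψ j g f (bijective_sumElim hg hf hgf hp), fun _ => rfl⟩

/-- Insertion of `κ(x, ·)` in the slot `j` of `φ`. -/
theorem exists_update {m n : ℕ}
    {φ : MultilinearMap R (fun _ : Fin n => Derivation k R R) (Derivation k R R)}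
    {κ : MultilinearMap R (fun _ : Fin (m + 1) => Derivation k R R) (Derivation k R R)}
    (hφ : IsSpecialTensor D φ) (hκ : IsSpecialTensor D κ) (j : Fin n) :
    ∃ χ : MultilinearMap R (fun _ : Fin (m + n) => Derivation k R R) (Derivation k R R),
      IsSpecialTensor D χ ∧ ∀ x, χ x = φ (Function.update (x ∘ Fin.natAdd m) j
        (κ (Fin.snoc (x ∘ Fin.castAdd n) (x (Fin.natAdd m j))))) := by
  obtain _ | n := n
  · exact j.elim0
  obtain ⟨χ, h1, h2⟩ := hφ.exists_subst hκ j
    (Fin.snoc (Fin.castAdd (n + 1)) (Fin.natAdd m j)) (Fin.natAdd m ∘ j.succAbove)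
    (by
      rw [Fin.snoc_injective_iff]
      refine ⟨Fin.castAdd_injective _ _, ?_⟩
      rintro ⟨i, hi⟩
      simp only [Fin.ext_iff, Fin.val_castAdd, Fin.val_natAdd] at hi
      omega)
    ((Fin.natAdd_injective _ _).comp Fin.succAbove_right_injective)
    (by
      intro i l
      refine Fin.lastCases ?_ (fun i => ?_) i
      · simp
      · simp only [Fin.snoc_castSucc, Function.comp_apply, ne_eq, Fin.ext_iff, Fin.val_castAdd,
          Fin.val_natAdd]
        omega)
    (by omega)
  refine ⟨χ, h1, fun x => ?_⟩
  rw [h2, ← Fin.insertNth_removeNth, Fin.comp_snoc]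
  rfl

theorem exists_lieTerm {m n : ℕ}
    {φ : MultilinearMap R (fun _ : Fin n => Derivation k R R) (Derivation k R R)}
    {τ : MultilinearMap R (fun _ : Fin m => Derivation k R R) (Derivation k R R)}
    {κ : MultilinearMap R (fun _ : Fin (m + 1) => Derivation k R R) (Derivation k R R)}
    (hφ : IsSpecialTensor D φ) (hτ : IsSpecialTensor D τ) (hκ : IsSpecialTensor D κ) :
    ∃ χ : MultilinearMap R (fun _ : Fin (m + n) => Derivation k R R) (Derivation k R R),
      IsSpecialTensor D χ ∧ ∀ x y, χ (Fin.append x y) =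
        lieTerm D φ (τ x) (fun z => κ (Fin.snoc x z)) y := by
  obtain ⟨χ₁, h1, h1'⟩ := hφ.covDeriv.exists_subst hτ 0 (Fin.castAdd n) (Fin.natAdd m)
    (Fin.castAdd_injective _ _) (Fin.natAdd_injective _ _)
    (fun i j => by
      simp only [ne_eq, Fin.ext_iff, Fin.val_castAdd, Fin.val_natAdd]
      omega) rfl
  obtain ⟨χ₂, h2, h2'⟩ := exists_sum Finset.univ (hφ.exists_update hκ)
  refine ⟨χ₁ + χ₂, h1.add h2, fun x y => ?_⟩
  have hx : (Fin.append x y : Fin (m + n) → Derivation k R R) ∘ Fin.castAdd n = x :=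
    funext fun i => Fin.append_left x y i
  have hy : (Fin.append x y : Fin (m + n) → Derivation k R R) ∘ Fin.natAdd m = y :=
    funext fun i => Fin.append_right x y i
  simp only [_root_.add_apply, h1', h2', hx, hy, Fin.append_right, Fin.insertNth_zero', lieTerm]

theorem exists_torsion_subst {m n : ℕ}
    {φ : MultilinearMap R (fun _ : Fin m => Derivation k R R) (Derivation k R R)}
    {ψ : MultilinearMap R (fun _ : Fin n => Derivation k R R) (Derivation k R R)}
    (hφ : IsSpecialTensor D φ) (hψ : IsSpecialTensor D ψ) :
    ∃ χ : MultilinearMap R (fun _ : Fin (m + n) => Derivation k R R) (Derivation k R R),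
      IsSpecialTensor D χ ∧ ∀ x y, χ (Fin.append x y) = LiePoly.torsion D ![φ x, ψ y] := by
  obtain ⟨χ₁, h1, h1'⟩ := (IsSpecialTensor.torsion (D := D) 0).exists_subst hφ 0 Fin.castSucc
    (fun _ => Fin.last m) (Fin.castSucc_injective _) (Function.injective_of_subsingleton _)
    (fun i j => Fin.castSucc_ne_last i) rfl
  obtain ⟨χ, h2, h2'⟩ := h1.exists_subst hψ (Fin.last m) (Fin.natAdd m) (Fin.castAdd n)
    (Fin.natAdd_injective _ _) (Fin.castAdd_injective _ _)
    (fun i j => by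
      simp only [ne_eq, Fin.ext_iff, Fin.val_castAdd, Fin.val_natAdd]
      omega) (by omega)
  refine ⟨χ, h2, fun x y => ?_⟩
  have hx : (Fin.append x y : Fin (m + n) → Derivation k R R) ∘ Fin.castAdd n = x :=
    funext fun i => Fin.append_left x y i
  have hy : (Fin.append x y : Fin (m + n) → Derivation k R R) ∘ Fin.natAdd m = y :=
    funext fun i => Fin.append_right x y i
  rw [h2', h1', hx, hy, Fin.insertNth_last', Fin.insertNth_zero', Fin.snoc_comp_castSucc]
  have hlast : ((Fin.snoc x (ψ y) : Fin (m + 1) → Derivation k R R) ∘ fun _ : Fin 1 => Fin.last m) =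
      ![ψ y] := funext fun i => by simp
  rw [hlast]
  rfl

theorem exists_curvature_subst {m n : ℕ}
    {φ : MultilinearMap R (fun _ : Fin m => Derivation k R R) (Derivation k R R)}
    {ψ : MultilinearMap R (fun _ : Fin n => Derivation k R R) (Derivation k R R)}
    (hφ : IsSpecialTensor D φ) (hψ : IsSpecialTensor D ψ) :
    ∃ χ : MultilinearMap R (fun _ : Fin (m + n + 1) => Derivation k R R) (Derivation k R R),
      IsSpecialTensor D χ ∧
        ∀ x y z, χ (Fin.snoc (Fin.append x y) z) = LiePoly.curvature D ![φ x, ψ y, z] := by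
  have h := disjoint_castSucc_natAdd_snoc m n
  obtain ⟨χ₁, h1, h1'⟩ := (IsSpecialTensor.curvature (D := D) 0).exists_subst hφ 0
    (Fin.castAdd 2) (Fin.natAdd m) (Fin.castAdd_injective _ _) (Fin.natAdd_injective _ _)
    (fun i j => by
      simp only [ne_eq, Fin.ext_iff, Fin.val_castAdd, Fin.val_natAdd]
      omega) rfl
  obtain ⟨χ, h2, h2'⟩ := h1.exists_subst hψ (p := m + n + 1) (Fin.last m).castSucc
    (Fin.castSucc ∘ Fin.natAdd m) (Fin.snoc (Fin.castSucc ∘ Fin.castAdd n) (Fin.last (m + n)))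
    h.1 h.2.1 h.2.2 (by omega)
  refine ⟨χ, h2, fun x y z => ?_⟩
  have hins : ((Fin.last m).castSucc.insertNth (ψ y) (Fin.snoc x z : Fin (m + 1) → _) :
      Fin (m + 2) → Derivation k R R) = Fin.append x ![ψ y, z] := by
    rw [Fin.insertNth_eq_iff]
    refine ⟨(Fin.append_right x ![ψ y, z] 0).symm, funext fun i => ?_⟩
    refine Fin.lastCases ?_ (fun i => ?_) i
    · rw [Fin.snoc_last, Fin.removeNth_apply, Fin.succAbove_castSucc_self]
      exact (Fin.append_right x ![ψ y, z] 1).symm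
    · rw [Fin.snoc_castSucc, Fin.removeNth_apply,
        Fin.succAbove_castSucc_of_lt _ _ (Fin.castSucc_lt_last i)]
      exact (Fin.append_left x ![ψ y, z] i).symm
  rw [h2', h1', snoc_append_comp_snoc, snoc_append_comp_natAdd, hins, Fin.insertNth_zero']
  have hx' : (Fin.append x ![ψ y, z] : Fin (m + 2) → Derivation k R R) ∘ Fin.castAdd 2 = x :=
    funext fun i => Fin.append_left _ _ i
  have hy' : (Fin.append x ![ψ y, z] : Fin (m + 2) → Derivation k R R) ∘ Fin.natAdd m =
      ![ψ y, z] := funext fun i => Fin.append_right _ _ i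
  rw [hx', hy']
  rfl

end IsSpecialTensor

theorem tTensor_id (D : AffineConnection k R) :
    tTensor D ((incl k R).compMultilinearMap (idTensor k R)) = -idTensor k R := by
  ext x f
  exact congrArg Neg.neg (act_ι D (Connection.fn k R) (x 0) f)

theorem rTensor_id (D : AffineConnection k R) :
    rTensor D ((incl k R).compMultilinearMap (idTensor k R)) = 0 := by
  ext1 x
  obtain ⟨y, z, rfl⟩ : ∃ y z, x = Fin.snoc y z :=
    ⟨Fin.init x, x (Fin.last 1), (Fin.snoc_init_self x).symm⟩
  have h := congrFun (congrArg DFunLike.coe (tTensor_id D)) y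
  rw [tTensor_apply, _root_.neg_apply, neg_inj] at h
  have h' := act_eq_nabla_add_curvAct D ((incl k R).compMultilinearMap (idTensor k R) y) z
  rw [h, ← sub_eq_iff_eq_add'] at h'
  rw [rTensor_snoc, ← h', _root_.zero_apply, sub_eq_zero]
  exact act_ι D D (y 0) z

theorem IsLieMonomial.isSpecialTensor (D : AffineConnection k R) {n : ℕ}
    {α : MultilinearMap R (fun _ : Fin n => Derivation k R R) (freeLie k R)}
    (hα : IsLieMonomial α) :
    IsSpecialTensor D (tTensor D α) ∧ IsSpecialTensor D (rTensor D α) := by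
  induction hα with
  | id =>
    refine ⟨?_, ?_⟩
    · rw [tTensor_id]; exact IsSpecialTensor.id.neg
    · rw [rTensor_id]; exact .zero 2
  | @perm n α σ _ ih =>
    refine ⟨ih.1.relabel σ σ.bijective fun x => rfl, ih.2.relabel
      (Fin.snoc (Fin.castSucc ∘ σ) (Fin.last n)) ?_ fun x => ?_⟩
    · refine (Fintype.bijective_iff_injective_and_card _).2 ⟨?_, rfl⟩
      rw [Fin.snoc_injective_iff]
      refine ⟨(Fin.castSucc_injective _).comp σ.injective, ?_⟩
      rintro ⟨i, hi⟩
      exact Fin.castSucc_ne_last _ hi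
    · rw [Fin.comp_snoc, rTensor_snoc, ← Fin.snoc_init_self x, rTensor_snoc]
      simp [Fin.init, Function.comp_def]
  | @bracket m n α β hα hβ ihα ihβ =>
    -- the term with `α` and `β` exchanged has the variables of `β` first; these lists of variables
    -- bring them into the order of `lieConcat α β`
    have hswap : Function.Injective
        (Fin.append (Fin.natAdd m) (Fin.castAdd n) : Fin (n + m) → Fin (m + n)) := by
      rw [Fin.append_injective_iff]
      refine ⟨Fin.natAdd_injective _ _, Fin.castAdd_injective _ _, fun i j => ?_⟩
      simp only [ne_eq, Fin.ext_iff, Fin.val_castAdd, Fin.val_natAdd]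
      omega
    have hswap' : Function.Injective
        (Fin.append (Fin.castSucc ∘ Fin.natAdd m)
          (Fin.snoc (Fin.castSucc ∘ Fin.castAdd n) (Fin.last _)) :
          Fin (n + (m + 1)) → Fin (m + n + 1)) := by
      obtain ⟨h1, h2, h3⟩ := disjoint_castSucc_natAdd_snoc m n
      exact Fin.append_injective_iff.2 ⟨h1, h2, h3⟩
    constructor
    · obtain ⟨χ₁, h1, h1'⟩ := ihα.1.exists_torsion_subst ihβ.1
      obtain ⟨χ₂, h2, h2'⟩ := ihβ.1.exists_lieTerm ihα.1 ihα.2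
      obtain ⟨χ₃, h3, h3'⟩ := ihα.1.exists_lieTerm ihβ.1 ihβ.2
      obtain ⟨χ₄, h4, h4'⟩ := h3.exists_relabel _ hswap (by omega)
      have : tTensor D (lieConcat α β) = χ₁ + -χ₂ + χ₄ := by
        ext1 x
        obtain ⟨y, z, rfl⟩ : ∃ y z, x = Fin.append y z :=
          ⟨_, _, (Fin.append_castAdd_natAdd (f := x)).symm⟩
        have hx : (Fin.append y z : Fin (m + n) → Derivation k R R) ∘
            (Fin.append (Fin.natAdd m) (Fin.castAdd n) : Fin (n + m) → Fin (m + n)) =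
            Fin.append z y := by
          ext1 i; refine Fin.addCases (fun i => ?_) (fun i => ?_) i <;> simp
        simp only [_root_.add_apply, _root_.neg_apply, h1', h2', h4', hx, h3',
          tTensor_lieConcat D hα hβ]
        abel
      rw [this]
      exact (h1.add h2.neg).add h4
    · obtain ⟨χ₁, h1, h1'⟩ := ihα.1.exists_curvature_subst ihβ.1
      obtain ⟨χ₂, h2, h2'⟩ := ihβ.2.exists_lieTerm ihα.1 ihα.2
      obtain ⟨χ₃, h3, h3'⟩ := ihα.2.exists_lieTerm ihβ.1 ihβ.2
      obtain ⟨χ₄, h4, h4'⟩ := h3.exists_relabel _ hswap' (by omega)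
      have : rTensor D (lieConcat α β) = χ₁ + -χ₂ + χ₄ := by
        ext1 x
        obtain ⟨y, z, a, rfl⟩ : ∃ (y : Fin m → Derivation k R R) (z : Fin n → Derivation k R R)
            (a : Derivation k R R), x = Fin.snoc (Fin.append y z) a :=
          ⟨_, _, x (Fin.last _), by
            rw [Fin.append_castAdd_natAdd (f := Fin.init x), Fin.snoc_init_self]⟩
        have hx : (Fin.snoc (Fin.append y z) a : Fin (m + n + 1) → Derivation k R R) ∘
            (Fin.append (Fin.castSucc ∘ Fin.natAdd m)
              (Fin.snoc (Fin.castSucc ∘ Fin.castAdd n) (Fin.last _)) :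
              Fin (n + (m + 1)) → Fin (m + n + 1)) = Fin.append z (Fin.snoc y a) := by
          rw [comp_append, snoc_append_comp_natAdd, snoc_append_comp_snoc]
        have h2'' := h2' y (Fin.snoc z a)
        rw [Fin.append_snoc] at h2''
        simp only [_root_.add_apply, _root_.neg_apply, h1', h4', hx, h3',
          rTensor_lieConcat D hα hβ]
        rw [h2'']
        abel
      rw [this]
      exact (h1.add h2.neg).add h4

/-! ### Torsion and curvature as tensors of the bracket, and the equality of the operads -/

/-- The Lie monomial `[x, y]`. -/
theorem isLieMonomial_bracket (k : Type w) (R : Type u) [CommRing k] [CommRing R] [Algebra k R] :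
    IsLieMonomial (lieConcat ((incl k R).compMultilinearMap (idTensor k R))
      ((incl k R).compMultilinearMap (idTensor k R))) :=
  .bracket .id .id

theorem tTensor_bracket (D : AffineConnection k R) :
    tTensor D (lieConcat ((incl k R).compMultilinearMap (idTensor k R))
      ((incl k R).compMultilinearMap (idTensor k R))) = torsion D := by
  ext1 x
  obtain ⟨y, z, rfl⟩ : ∃ (y z : Fin 1 → Derivation k R R), x = Fin.append y z :=
    ⟨_, _, (Fin.append_castAdd_natAdd (m := 1) (n := 1) (f := x)).symm⟩
  rw [tTensor_lieConcat D .id .id, tTensor_id, rTensor_id]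
  simp [lieTerm, covDeriv_neg, covDeriv_idTensor, torsion_apply]
  rfl

theorem rTensor_bracket (D : AffineConnection k R) :
    rTensor D (lieConcat ((incl k R).compMultilinearMap (idTensor k R))
      ((incl k R).compMultilinearMap (idTensor k R))) = curvature D := by
  ext1 x
  obtain ⟨y, z, a, rfl⟩ : ∃ (y z : Fin 1 → Derivation k R R) (a : Derivation k R R),
      x = Fin.snoc (Fin.append y z) a :=
    ⟨_, _, x (Fin.last _), by
      rw [Fin.append_castAdd_natAdd (m := 1) (n := 1) (f := Fin.init x), Fin.snoc_init_self]⟩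
  rw [rTensor_lieConcat D .id .id, tTensor_id, rTensor_id]
  simp [lieTerm, covDeriv_zero, curvature_apply]
  rfl

/-- The equality of the two operads over an arbitrary commutative algebra. -/
theorem lieTypePolynomials_eq_specialPolynomials (D : AffineConnection k R) :
    lieTypePolynomials D = specialPolynomials D := by
  refine Suboperad.ext (funext fun n => le_antisymm ?_ ?_)
  · refine Suboperad.generated_le _ (fun n φ hφ => ?_) n
    obtain ⟨α, hα, m⟩ | ⟨α, hα, m⟩ := hφ
    · exact ((hα.isSpecialTensor D).1.iterCovDeriv m).mem_specialPolynomials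
    · exact ((hα.isSpecialTensor D).2.iterCovDeriv m).mem_specialPolynomials
  · refine Suboperad.generated_le _ (fun n φ hφ => ?_) n
    obtain m | m := hφ
    · rw [← tTensor_bracket]
      exact Suboperad.subset_generated _ _
        (IsLieTypeGenerator.torsion _ (isLieMonomial_bracket k R) m)
    · rw [← rTensor_bracket]
      exact Suboperad.subset_generated _ _
        (IsLieTypeGenerator.curvature _ (isLieMonomial_bracket k R) m)

end

end LiePoly

end

theorem mainTheorem1 (d : ℕ) (M : Type*) [TopologicalSpace M] [T2Space M]
    [SecondCountableTopology M] [ChartedSpace (EuclideanSpace ℝ (Fin d)) M] [IsManifold (𝓡 d) ∞ M]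
    (D : LiePoly.AffineConnection ℝ C^∞⟮𝓡 d, M; ℝ⟯) :
    LiePoly.lieTypePolynomials D = LiePoly.specialPolynomials D :=
  LiePoly.lieTypePolynomials_eq_specialPolynomials D
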